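/- Let $K$ be an abstract simplicial complex on the vertex set $[m]=\{1,\dots,m\}$, that is, a family of subsets of $[m]$ that is closed under passing to subsets and contains $\emptyset$ and every singleton $\{i\}$. For a pair of spaces $W\subseteq X$ put $$K(X,W)=\bigcup_{\sigma\in K}\{(x_1,\dots,x_m)\in X^m : x_i\in W \text{ for all } i\notin\sigma\}\subseteq X^m .$$ Let $\mathcal Z_K=K(D^2,S^1)$ be the moment-angle complex, where $D^2=\{z\in\mathbb C:|z|\le 1\}$ and $S^1=\partial D^2$, and let $\mathbb R\mathcal Z_K=K(D^1,S^0)$ be the real moment-angle complex, where $D^1=[-1,1]$ and $S^0=\{\pm1\}$. The torus $T^m=(S^1)^m$ acts on $\mathcal Z_K$, and the group $(\mathbb Z_2)^m=\{\pm1\}^m$ acts on $\mathbb R\mathcal Z_K$, by coordinatewise multiplication. Let $\mathbf k$ be any field, and let $H^i(-;\mathbf k)$ denote singular cohomology. Then the total Betti numbers of $\mathcal Z_K$ and $\mathbb R\mathcal Z_K$ over $\mathbf k$ are finite and equal: $$\sum_i\dim_{\mathbf k}H^i(\mathcal Z_K;\mathbf k)=\sum_i\dim_{\mathbf k}H^i(\mathbb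 R\mathcal Z_K;\mathbf k)<\infty .$$ Moreover, if some subtorus $H\le T^m$ of rank $r$ (a subgroup isomorphic to $T^r$ as a topological group) acts freely on $\mathcal Z_K$ by restriction of the $T^m$-action, or if some subgroup $H_{\mathbb R}\le(\mathbb Z_2)^m$ of rank $r$ (isomorphic to $(\mathbb Z_2)^r$) acts freely on $\mathbb R\mathcal Z_K$ by restriction of the $(\mathbb Z_2)^m$-action, then this common number is at least $2^r$. -/

import Mathlib

universe u

/-- The polyhedral product `K(X, W) ⊆ E^m` of a pair of subsets `X`, `W` of `E`: the union, over the
simplices `σ` of `K`, of the products `∏ A_i` with `A_i = X` for `i ∈ σ` and `A_i = W` for `i ∉ σ`.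
Since the faces of an `AbstractSimplicialComplex` are by convention nonempty, the empty simplex is
added explicitly. -/
def polyhedralProduct {m : ℕ} {E : Type*} (K : AbstractSimplicialComplex (Fin m)) (X W : Set E) :
    Set (Fin m → E) :=
  {z | ∃ σ : Finset (Fin m), (σ = ∅ ∨ σ ∈ K.faces) ∧ ∀ i, (i ∈ σ → z i ∈ X) ∧ (i ∉ σ → z i ∈ W)}

/-- The moment-angle complex `Z_K = K(D², S¹) ⊆ ℂ^m`. -/
def momentAngleComplex {m : ℕ} (K : AbstractSimplicialComplex (Fin m)) : Set (Fin m → ℂ) :=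
  polyhedralProduct K (Metric.closedBall 0 1) (Metric.sphere 0 1)

/-- The real moment-angle complex `ℝZ_K = K(D¹, S⁰) ⊆ ℝ^m`. -/
def realMomentAngleComplex {m : ℕ} (K : AbstractSimplicialComplex (Fin m)) : Set (Fin m → ℝ) :=
  polyhedralProduct K (Metric.closedBall 0 1) (Metric.sphere 0 1)

/-- The coordinatewise action of the torus `T^m` on `Z_K`. -/
instance momentAngleComplex.instMulAction {m : ℕ} (K : AbstractSimplicialComplex (Fin m)) :
    MulAction (Fin m → Circle) (momentAngleComplex K) where
  smul g z := ⟨fun i => (g i : ℂ) * z.1 i, by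
    obtain ⟨σ, hσ, h⟩ := z.2
    exact ⟨σ, hσ, fun i => ⟨fun hi => by simpa [Circle.norm_coe] using (h i).1 hi,
      fun hi => by simpa [Circle.norm_coe] using (h i).2 hi⟩⟩⟩
  one_smul z := Subtype.ext (funext fun i => by
    change ((1 : Circle) : ℂ) * z.1 i = z.1 i
    simp)
  mul_smul g h z := Subtype.ext (funext fun i => by
    change ((g i * h i : Circle) : ℂ) * z.1 i = (g i : ℂ) * ((h i : ℂ) * z.1 i)
    simp [mul_assoc])

/-- The coordinatewise action of `(ℤ/2)^m = {1, -1}^m` on `ℝZ_K`. -/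
instance realMomentAngleComplex.instMulAction {m : ℕ} (K : AbstractSimplicialComplex (Fin m)) :
    MulAction (Fin m → ℤˣ) (realMomentAngleComplex K) where
  smul g x := ⟨fun i => ((g i : ℤ) : ℝ) * x.1 i, by
    obtain ⟨σ, hσ, h⟩ := x.2
    have habs : ∀ i, |((g i : ℤ) : ℝ)| = 1 := fun i => by
      rcases Int.units_eq_one_or (g i) with hg | hg <;> simp [hg]
    exact ⟨σ, hσ, fun i => ⟨fun hi => by simpa [abs_mul, habs] using (h i).1 hi,
      fun hi => by simpa [abs_mul, habs] using (h i).2 hi⟩⟩⟩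
  one_smul x := Subtype.ext (funext fun i => by
    change (((1 : ℤˣ) : ℤ) : ℝ) * x.1 i = x.1 i
    simp)
  mul_smul g h x := Subtype.ext (funext fun i => by
    change (((g i * h i : ℤˣ) : ℤ) : ℝ) * x.1 i = ((g i : ℤ) : ℝ) * (((h i : ℤ) : ℝ) * x.1 i)
    simp [mul_assoc])

/-- `H` is a subtorus of rank `r` of `T^m`: a subgroup isomorphic to `T^r` as a topological group
(with the subspace topology). -/
def IsSubtorusOfRank {m : ℕ} (H : Subgroup (Fin m → Circle)) (r : ℕ) : Prop :=
  Nonempty (H ≃ₜ* (Fin r → Circle))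

/-- `H` is a subgroup of rank `r` of `(ℤ/2)^m`: a subgroup isomorphic to `(ℤ/2)^r`. -/
def IsTwoSubtorusOfRank {m : ℕ} (H : Subgroup (Fin m → ℤˣ)) (r : ℕ) : Prop :=
  Nonempty (H ≃* (Fin r → ℤˣ))

/-- The singular cochain complex `Hom_k(C_*(X; k), k)` of a topological space. -/
noncomputable def singularCochainComplex (k : Type u) [Field k] (X : Type) [TopologicalSpace X] :
    CochainComplex (ModuleCat.{u} k) ℕ :=
  (((AlgebraicTopology.singularChainComplexFunctor (ModuleCat.{u} k)).obj
    (ModuleCat.of k k)).obj (TopCat.of X)).linearYonedaObj k (ModuleCat.of k k)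

/-- The singular cohomology `H^i(X; k)`. -/
noncomputable def singularCohomology (k : Type u) [Field k] (X : Type) [TopologicalSpace X]
    (i : ℕ) : ModuleCat.{u} k :=
  (singularCochainComplex k X).homology i

/-- The total Betti number `∑_i dim_k H^i(X; k)`, as a cardinal number. -/
noncomputable def totalBetti (k : Type u) [Field k] (X : Type) [TopologicalSpace X] :
    Cardinal.{u} :=
  Cardinal.sum fun i : ℕ => Module.rank k (singularCohomology k X i)

/-!
Over each coordinate, both complexes are unions `A × D ∪ X × S` with `D` a disc and `S` its boundary
sphere, where `A ⊆ X` are the spaces of the same kind built from the link and the deletion of a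
vertex. The points off one pole of the disc contract to the opposite pole, hence to `X`, and the
points off both poles contract to the same union for the equatorial disc. So the Mayer–Vietoris
sequence computes the total Betti number from the map `H(A) → H(X)` alone, and the result does not
depend on the dimension of the disc as long as it is positive. Exchanging the discs `D²` for `D¹`
one coordinate at a time gives the equality of the total Betti numbers.

The same computation shows that the total Betti number is at least that of `A`, and twice that of
`X` if `A` is empty. By induction on `m` it is therefore at least `2 ^ (m - |σ|)` for some simplex
`σ`. If a group acts freely, then only its unit fixes a point whose coordinates in `σ` vanish, so an
elementary abelian `2`-subgroup embeds into the `m - |σ|` remaining coordinates.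
-/

open CategoryTheory Limits HomologicalComplex Opposite
open scoped DirectSum

section ExactTriangle

variable {k A B C : Type*} [DivisionRing k] [AddCommGroup A] [AddCommGroup B] [AddCommGroup C]
  [Module k A] [Module k B] [Module k C] {α : A →ₗ[k] B} {β : B →ₗ[k] C} {γ : C →ₗ[k] A}

lemma finite_of_exact [Module.Finite k A] [Module.Finite k C] (h : Function.Exact α β) :
    Module.Finite k B := by
  refine ⟨Submodule.fg_of_fg_map_of_fg_inf_ker β (IsNoetherian.noetherian _) ?_⟩
  rw [top_inf_eq, h.linearMap_ker_eq]
  exact Module.Finite.fg_top.map α |> (LinearMap.range_eq_map α ▸ ·)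

lemma finrank_add_two_mul_finrank_range [Module.Finite k A] [Module.Finite k B]
    [Module.Finite k C] (hαβ : Function.Exact α β) (hβγ : Function.Exact β γ)
    (hγα : Function.Exact γ α) :
    Module.finrank k C + 2 * Module.finrank k (LinearMap.range α) =
      Module.finrank k A + Module.finrank k B := by
  have hA := α.finrank_range_add_finrank_ker
  have hB := β.finrank_range_add_finrank_ker
  have hC := γ.finrank_range_add_finrank_ker
  rw [hγα.linearMap_ker_eq] at hA
  rw [hαβ.linearMap_ker_eq] at hB
  rw [hβγ.linearMap_ker_eq] at hC
  lia

end ExactTriangle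

/-- The total homology `⨁ i, H_i(K)` of a chain complex of modules, as an ungraded module. -/
abbrev TotalHomology {k : Type u} [CommRing k] (K : ChainComplex (ModuleCat.{u} k) ℕ) : Type u :=
  ⨁ i, K.homology i

namespace TotalHomology

section Functoriality

variable {k : Type u} [CommRing k] {K L M : ChainComplex (ModuleCat.{u} k) ℕ}

/-- The map induced on total homology by a chain map. -/
noncomputable def map (f : K ⟶ L) : TotalHomology K →ₗ[k] TotalHomology L :=
  DirectSum.lmap fun i => (homologyMap f i).hom

lemma map_apply (f : K ⟶ L) (x : TotalHomology K) (i : ℕ) :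
    map f x i = homologyMap f i (x i) := rfl

lemma map_id : map (𝟙 K) = LinearMap.id := by
  simp [map]

lemma map_comp (f : K ⟶ L) (g : L ⟶ M) : map (f ≫ g) = map g ∘ₗ map f := by
  simp [map, homologyMap_comp]

lemma map_add (f g : K ⟶ L) : map (f + g) = map f + map g := by
  ext x i
  simp [map_apply, homologyMap_add]

lemma map_zero : map (0 : K ⟶ L) = 0 := by
  ext x i
  simp [map_apply]

lemma map_neg (f : K ⟶ L) : map (-f) = -map f :=
  eq_neg_of_add_eq_zero_left (by rw [← map_add, neg_add_cancel, map_zero])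

/-- Total homology takes direct sums of chain complexes to direct sums of modules. -/
noncomputable def biprodEquiv (K L : ChainComplex (ModuleCat.{u} k) ℕ) :
    TotalHomology (K ⊞ L) ≃ₗ[k] TotalHomology K × TotalHomology L :=
  .ofLinearMap ((map biprod.fst).prod (map biprod.snd)) ((map biprod.inl).coprod (map biprod.inr))
    (by
      refine LinearMap.prod_ext ?_ ?_ <;>
        simp only [LinearMap.comp_assoc, LinearMap.coprod_inl, LinearMap.coprod_inr,
          LinearMap.prod_comp, ← map_comp, biprod.inl_fst, biprod.inl_snd, biprod.inr_fst,
          biprod.inr_snd, map_id, map_zero, LinearMap.id_comp] <;> rfl)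
    (by
      rw [LinearMap.coprod_comp_prod, ← map_comp, ← map_comp, ← map_add, biprod.total, map_id])

end Functoriality

section LongExactSequence

variable {k : Type u} [CommRing k]
  {S : ShortComplex (ChainComplex (ModuleCat.{u} k) ℕ)} (hS : S.ShortExact)

/-- The direct sum of the connecting homomorphisms of the long exact homology sequence; it lowers
degrees by one and vanishes on `H_0`. -/
noncomputable def connectingMap : TotalHomology S.X₃ →ₗ[k] TotalHomology S.X₁ :=
  DirectSum.toModule k ℕ _ fun
    | 0 => 0
    | i + 1 => DirectSum.lof k ℕ (fun i => S.X₁.homology i) i ∘ₗ (hS.δ (i + 1) i rfl).hom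

lemma connectingMap_apply (x : TotalHomology S.X₃) (i : ℕ) :
    connectingMap hS x i = hS.δ (i + 1) i rfl (x (i + 1)) := by
  suffices h : DirectSum.component k ℕ _ i ∘ₗ connectingMap hS =
    (hS.δ (i + 1) i rfl).hom ∘ₗ DirectSum.component k ℕ _ (i + 1) from DFunLike.congr_fun h x
  ext (_ | j) y
  · simp [connectingMap, DirectSum.component.of]
  · obtain rfl | h := eq_or_ne j i
    · simp [connectingMap]
    · simp [connectingMap, DirectSum.component.of, h]

lemma exact_map_map (hS : S.ShortExact) : Function.Exact (map S.f) (map S.g) := by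
  rw [LinearMap.exact_iff, map, map, DirectSum.ker_lmap, DirectSum.range_lmap]
  congr! 3 with i
  exact LinearMap.exact_iff.1 ((ShortComplex.ShortExact.moduleCat_exact_iff_function_exact _).1
    (hS.homology_exact₂ i))

lemma exact_map_connectingMap : Function.Exact (map S.g) (connectingMap hS) := by
  have hdeg (i : ℕ) := (ShortComplex.ShortExact.moduleCat_exact_iff_function_exact _).1
    (hS.homology_exact₃ (i + 1) i rfl)
  have hepi : Function.Surjective (homologyMap S.g 0) := by
    have := hS.epi_g
    rw [← ModuleCat.epi_iff_surjective]
    exact epi_homologyMap_of_epi_of_not_rel S.g 0 (by simp)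
  intro x
  rw [← LinearMap.coe_range, SetLike.mem_coe, map, DirectSum.range_lmap]
  constructor
  · rintro hx (_ | i) -
    · exact hepi _
    · exact (hdeg i _).1 ((connectingMap_apply hS x i).symm.trans (congrArg (DFunLike.coe · i) hx))
  · intro hx
    ext i
    rw [connectingMap_apply]
    exact (hdeg i _).2 (hx (i + 1) trivial)

lemma exact_connectingMap_map : Function.Exact (connectingMap hS) (map S.f) := by
  have hdeg (i : ℕ) := (ShortComplex.ShortExact.moduleCat_exact_iff_function_exact _).1
    (hS.homology_exact₁ (i + 1) i rfl)
  classical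
  intro y
  constructor
  · intro hy
    rw [← LinearMap.coe_range, SetLike.mem_coe, ← DirectSum.sum_support_of y]
    refine Submodule.sum_mem _ fun i _ => ?_
    obtain ⟨x, hx⟩ := (hdeg i _).1 (congrArg (DFunLike.coe · i) hy)
    refine ⟨DirectSum.lof k ℕ (fun i => S.X₃.homology i) (i + 1) x, ?_⟩
    rw [← hx]
    exact DirectSum.toModule_lof ..
  · rintro ⟨x, rfl⟩
    ext i
    rw [map_apply, connectingMap_apply]
    exact (hdeg i).apply_apply_eq_zero _

lemma acyclic_cokernel {K L : ChainComplex (ModuleCat.{u} k) ℕ} (g : K ⟶ L)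
    (h : ∀ n (c : L.X n), (∀ j, L.d n j c ∈ LinearMap.range (g.f j).hom) →
      ∃ e, c - L.d (n + 1) n e ∈ LinearMap.range (g.f n).hom) :
    (cokernel g).Acyclic := by
  have hker (n : ℕ) : Function.Exact (g.f n) ((cokernel.π g).f n) :=
    (ShortComplex.ShortExact.moduleCat_exact_iff_function_exact _).1
      ((ShortComplex.exact_cokernel g).map (eval _ _ n))
  intro n
  rw [exactAt_iff' _ (n + 1) n _ (by simp) rfl,
    ShortComplex.ShortExact.moduleCat_exact_iff_function_exact]
  intro z
  constructor
  · intro hz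
    obtain ⟨c, rfl⟩ := (ModuleCat.epi_iff_surjective ((cokernel.π g).f n)).1 inferInstance z
    obtain ⟨e, he⟩ := h n c fun j => by
      by_cases hj : (ComplexShape.down ℕ).Rel n j
      · obtain rfl := (ComplexShape.down ℕ).next_eq' hj
        refine (hker _ _).1 ?_
        exact (ConcreteCategory.congr_hom ((cokernel.π g).comm n _) c).symm.trans hz
      · rw [L.shape n j hj]
        exact zero_mem _
    refine ⟨(cokernel.π g).f (n + 1) e, ?_⟩
    refine (ConcreteCategory.congr_hom ((cokernel.π g).comm (n + 1) n) e).trans ?_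
    have := (hker n _).2 he
    rw [_root_.map_sub, sub_eq_zero] at this
    exact this.symm
  · rintro ⟨x, rfl⟩
    exact ((cokernel g).sc' (n + 1) n _).moduleCat_zero_apply x

lemma subsingleton_of_acyclic {K : ChainComplex (ModuleCat.{u} k) ℕ} (hK : K.Acyclic) :
    Subsingleton (TotalHomology K) := by
  have (i : ℕ) : Subsingleton (K.homology i) :=
    ModuleCat.subsingleton_of_isZero (hK i).isZero_homology
  exact inferInstanceAs (Subsingleton (Π₀ i, K.homology i))

lemma map_bijective_of_acyclic (hS : S.ShortExact) (hQ : S.X₃.Acyclic) :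
    Function.Bijective (map S.f) := by
  have := subsingleton_of_acyclic hQ
  constructor
  · rw [injective_iff_map_eq_zero]
    intro x hx
    obtain ⟨y, rfl⟩ := (exact_connectingMap_map hS x).1 hx
    rw [Subsingleton.elim y 0, _root_.map_zero]
  · exact fun y => (exact_map_map hS y).1 (Subsingleton.elim _ _)

end LongExactSequence

section FiniteDimensional

variable {k : Type u} [Field k] {S : ShortComplex (ChainComplex (ModuleCat.{u} k) ℕ)}

lemma finite_and_finrank_of_shortExact (hS : S.ShortExact) [Module.Finite k (TotalHomology S.X₁)]
    [Module.Finite k (TotalHomology S.X₂)] :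
    Module.Finite k (TotalHomology S.X₃) ∧
      Module.finrank k (TotalHomology S.X₃) + 2 * Module.finrank k (LinearMap.range (map S.f)) =
        Module.finrank k (TotalHomology S.X₁) + Module.finrank k (TotalHomology S.X₂) := by
  have := finite_of_exact (exact_map_connectingMap hS)
  exact ⟨this, finrank_add_two_mul_finrank_range (exact_map_map hS) (exact_map_connectingMap hS)
    (exact_connectingMap_map hS)⟩

lemma finite_and_finrank_of_exact (hS : S.Exact) [Mono S.f]
    [Module.Finite k (TotalHomology S.X₁)] [Module.Finite k (TotalHomology S.X₂)]
    (hg : (cokernel S.g).Acyclic) :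
    Module.Finite k (TotalHomology S.X₃) ∧
      Module.finrank k (TotalHomology S.X₃) + 2 * Module.finrank k (LinearMap.range (map S.f)) =
        Module.finrank k (TotalHomology S.X₁) + Module.finrank k (TotalHomology S.X₂) := by
  have hzero : S.f ≫ Abelian.factorThruImage S.g = 0 := by
    rw [← cancel_mono (Abelian.image.ι S.g), Category.assoc, Abelian.image.fac, S.zero, zero_comp]
  have himage : (ShortComplex.mk S.f (Abelian.factorThruImage S.g) hzero).ShortExact :=
    { exact := by
        let φ : ShortComplex.mk S.f (Abelian.factorThruImage S.g) hzero ⟶ S :=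
          { τ₁ := 𝟙 _, τ₂ := 𝟙 _, τ₃ := Abelian.image.ι S.g }
        exact (ShortComplex.exact_iff_of_epi_of_isIso_of_mono φ).2 hS }
  have hι : (ShortComplex.mk (Abelian.image.ι S.g) (cokernel.π S.g)
      (kernel.condition _)).ShortExact := { exact := ShortComplex.exact_kernel _ }
  let e := LinearEquiv.ofBijective _ (map_bijective_of_acyclic hι hg)
  obtain ⟨hfin, hrank⟩ := finite_and_finrank_of_shortExact himage
  exact ⟨.equiv e, e.finrank_eq ▸ hrank⟩

end FiniteDimensional

end TotalHomology

section Cohomology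

variable (k : Type u) [Field k]

/-- The functor taking a vector space to its dual, with values in the opposite category. -/
noncomputable abbrev dualFunctor : ModuleCat.{u} k ⥤ (ModuleCat.{u} k)ᵒᵖ :=
  ((linearYoneda k (ModuleCat k)).obj (ModuleCat.of k k)).rightOp

variable {k} in
lemma exact_dualMap_of_exact {V₁ V₂ V₃ : Type*} [AddCommGroup V₁] [AddCommGroup V₂]
    [AddCommGroup V₃] [Module k V₁] [Module k V₂] [Module k V₃] {f : V₁ →ₗ[k] V₂}
    {g : V₂ →ₗ[k] V₃} (h : Function.Exact f g) : Function.Exact g.dualMap f.dualMap := by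
  rw [LinearMap.exact_iff, LinearMap.ker_dualMap_eq_dualAnnihilator_range,
    LinearMap.range_dualMap_eq_dualAnnihilator_ker, h.linearMap_ker_eq]

instance : (dualFunctor k).PreservesHomology :=
  Functor.preservesHomology_of_map_exact _ fun S hS => by
    have hdual := exact_dualMap_of_exact
      ((ShortComplex.ShortExact.moduleCat_exact_iff_function_exact _).1 hS)
    rw [← ShortComplex.exact_unop_iff, ShortComplex.ShortExact.moduleCat_exact_iff_function_exact]
    intro φ
    refine ⟨fun h => ?_, ?_⟩
    · obtain ⟨ψ, hψ⟩ := (hdual (ModuleCat.Hom.hom φ)).1 (congrArg ModuleCat.Hom.hom h)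
      exact ⟨ModuleCat.ofHom ψ, ModuleCat.hom_ext hψ⟩
    · rintro ⟨ψ, rfl⟩
      exact (S.map (dualFunctor k)).unop.moduleCat_zero_apply ψ

/-- Universal coefficients over a field: cohomology is dual to homology. -/
noncomputable def dualHomologyEquiv (K : ChainComplex (ModuleCat.{u} k) ℕ) (i : ℕ) :
    (K.linearYonedaObj k (ModuleCat.of k k)).homology i ≃ₗ[k] Module.Dual k (K.homology i) :=
  ((homologyUnop (((dualFunctor k).mapHomologicalComplex _).obj K) i) ≪≫
    ((K.sc i).mapHomologyIso (dualFunctor k)).unop.symm).toLinearEquiv ≪≫ₗ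
    (ModuleCat.homLinearEquiv (S := k))

variable {k} in
lemma sum_rank_linearYonedaObj (K : ChainComplex (ModuleCat.{u} k) ℕ)
    [Module.Finite k (TotalHomology K)] :
    (Cardinal.sum fun i => Module.rank k ((K.linearYonedaObj k (ModuleCat.of k k)).homology i)) =
      Module.finrank k (TotalHomology K) := by
  have (i : ℕ) : Module.Finite k (K.homology i) :=
    .of_surjective (DirectSum.component k ℕ (fun i => K.homology i) i) fun x =>
      ⟨DirectSum.lof k ℕ _ i x, DirectSum.component.lof_self ..⟩
  rw [Module.finrank_eq_rank, rank_directSum]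
  congr! 2 with i
  rw [(dualHomologyEquiv k K i).rank_eq, ← Module.finrank_eq_rank, Subspace.dual_finrank_eq,
    Module.finrank_eq_rank]

end Cohomology

/-- Combinatorial chains of ordered simplices: formal combinations of `n`-tuples of vertices. The
index counts vertices, so `n`-tuples are simplices of dimension `n - 1` and `n = 0` is the
augmentation. -/
abbrev OrderedChain (k V : Type*) [CommRing k] (n : ℕ) : Type _ := (Fin n → V) →₀ k

namespace OrderedChain

variable {k V W : Type*} [CommRing k]

/-- The alternating sum of the faces. -/
noncomputable def boundary (n : ℕ) : OrderedChain k V (n + 1) →ₗ[k] OrderedChain k V n :=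
  Finsupp.linearCombination k fun w =>
    ∑ i : Fin (n + 1), (-1) ^ (i : ℕ) • .single (w ∘ i.succAbove) 1

/-- The cone with apex `v`, inserted as the first vertex. -/
noncomputable def cone (v : V) (n : ℕ) : OrderedChain k V n →ₗ[k] OrderedChain k V (n + 1) :=
  Finsupp.lmapDomain k k fun w => Fin.cons (α := fun _ => V) v w

/-- The chain map induced by a map of vertices. -/
noncomputable def map (f : V → W) (n : ℕ) : OrderedChain k V n →ₗ[k] OrderedChain k W n :=
  Finsupp.lmapDomain k k fun w => f ∘ w

lemma boundary_single (n : ℕ) (w : Fin (n + 1) → V) :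
    boundary n (.single w (1 : k)) =
      ∑ i : Fin (n + 1), (-1) ^ (i : ℕ) • .single (w ∘ i.succAbove) 1 := by
  simp [boundary]

@[simp]
lemma cone_single (v : V) (n : ℕ) (w : Fin n → V) (a : k) :
    cone v n (.single w a) = .single (Fin.cons v w : Fin (n + 1) → V) a := by
  simp [cone]

@[simp]
lemma map_single (f : V → W) (n : ℕ) (w : Fin n → V) (a : k) :
    map f n (.single w a) = .single (f ∘ w) a := by
  simp [map]

lemma map_boundary (f : V → W) (n : ℕ) (c : OrderedChain k V (n + 1)) :
    map f n (boundary n c) = boundary n (map f (n + 1) c) := by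
  suffices h : map f n ∘ₗ boundary n = boundary n ∘ₗ map f (n + 1) from LinearMap.congr_fun h c
  ext w : 2
  simp [boundary_single, Function.comp_assoc]

lemma map_cone (f : V → W) (v : V) (n : ℕ) (c : OrderedChain k V n) :
    map f (n + 1) (cone v n c) = cone (f v) n (map f n c) := by
  suffices h : map f (n + 1) ∘ₗ cone v n = cone (f v) n ∘ₗ map f n from LinearMap.congr_fun h c
  ext w : 2
  simp [Fin.comp_cons]

lemma single_eq_cone (n : ℕ) (w : Fin (n + 1) → V) (a : k) :
    (.single w a : OrderedChain k V (n + 1)) = cone (w 0) n (.single (Fin.tail w) a) := by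
  rw [cone_single, Fin.cons_self_tail]

lemma boundary_cone_zero (v : V) (c : OrderedChain k V 0) : boundary 0 (cone v 0 c) = c := by
  suffices h : boundary 0 ∘ₗ cone v 0 = LinearMap.id from LinearMap.congr_fun h c
  ext w : 2
  simp [boundary_single, Subsingleton.elim _ w]

lemma boundary_cone_succ (v : V) (n : ℕ) (c : OrderedChain k V (n + 1)) :
    boundary (n + 1) (cone v (n + 1) c) = c - cone v n (boundary n c) := by
  suffices h : boundary (n + 1) ∘ₗ cone v (n + 1) = LinearMap.id - cone v n ∘ₗ boundary n from
    LinearMap.congr_fun h c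
  ext w : 2
  have hsucc (i : Fin (n + 1)) : (Fin.cons v w : Fin (n + 2) → V) ∘ i.succ.succAbove =
      Fin.cons v (w ∘ i.succAbove) := by
    ext j
    cases j using Fin.cases <;> simp
  simp [boundary_single, Fin.sum_univ_succ (n := n + 1), hsucc, pow_succ, sub_eq_add_neg]

lemma boundary_boundary (n : ℕ) (c : OrderedChain k V (n + 2)) :
    boundary n (boundary (n + 1) c) = 0 := by
  induction n with
  | zero =>
    suffices h : boundary 0 ∘ₗ boundary 1 = 0 from LinearMap.congr_fun h c
    ext w : 2
    simp [single_eq_cone, boundary_cone_succ, boundary_cone_zero, -cone_single]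
  | succ n ih =>
    suffices h : boundary (n + 1) ∘ₗ boundary (n + 2) = 0 from LinearMap.congr_fun h c
    ext w : 2
    rw [LinearMap.comp_apply, LinearMap.comp_apply, LinearMap.comp_apply, Finsupp.lsingle_apply,
      single_eq_cone, boundary_cone_succ, map_sub, boundary_cone_succ, ih]
    simp

variable (b : ∀ n, (Fin (n + 1) → V) → V)

/-- The subdivision of a simplex `w` as the cone over its subdivided boundary, with apex an
arbitrary point `b n w` in the role of the barycenter. -/
noncomputable def subdivision : ∀ n, OrderedChain k V n →ₗ[k] OrderedChain k V n
  | 0 => LinearMap.id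
  | n + 1 => Finsupp.linearCombination k fun w =>
      cone (b n w) n (subdivision n (boundary n (.single w 1)))

/-- The chain homotopy from the identity to `subdivision b`. -/
noncomputable def subdivisionHomotopy : ∀ n, OrderedChain k V n →ₗ[k] OrderedChain k V (n + 1)
  | 0 => 0
  | n + 1 => Finsupp.linearCombination k fun w =>
      cone (b n w) (n + 1) (.single w 1 - subdivisionHomotopy n (boundary n (.single w 1)))

lemma subdivision_single (n : ℕ) (w : Fin (n + 1) → V) :
    subdivision b (n + 1) (.single w (1 : k)) =
      cone (b n w) n (subdivision b n (boundary n (.single w 1))) := by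
  simp [subdivision]

lemma subdivisionHomotopy_single (n : ℕ) (w : Fin (n + 1) → V) :
    subdivisionHomotopy b (n + 1) (.single w (1 : k)) =
      cone (b n w) (n + 1) (.single w 1 - subdivisionHomotopy b n (boundary n (.single w 1))) := by
  simp [subdivisionHomotopy]

lemma boundary_subdivisionHomotopy (n : ℕ) (c : OrderedChain k V (n + 1)) :
    boundary (n + 1) (subdivisionHomotopy b (n + 1) c) =
      c - subdivision b (n + 1) c - subdivisionHomotopy b n (boundary n c) := by
  suffices h : boundary (n + 1) ∘ₗ subdivisionHomotopy b (n + 1) =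
      LinearMap.id - subdivision b (n + 1) - subdivisionHomotopy b n ∘ₗ boundary n from
    LinearMap.congr_fun h c
  clear c
  induction n with
  | zero =>
    ext w : 2
    simp [boundary_cone_succ, subdivision, subdivisionHomotopy, -cone_single]
  | succ n ih =>
    ext w : 2
    have ih' := LinearMap.congr_fun ih (boundary (n + 1) (.single w 1))
    simp only [LinearMap.comp_apply, LinearMap.sub_apply, LinearMap.id_apply, boundary_boundary,
      map_zero, sub_zero] at ih'
    simp [subdivision_single, subdivisionHomotopy_single, boundary_cone_succ, ih', -cone_single]
    abel

variable {b} {b' : ∀ n, (Fin (n + 1) → W) → W} {f : V → W}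

lemma map_subdivision (hf : ∀ n w, f (b n w) = b' n (f ∘ w)) (n : ℕ) (c : OrderedChain k V n) :
    map f n (subdivision b n c) = subdivision b' n (map f n c) := by
  induction n with
  | zero => rfl
  | succ n ih =>
    suffices h : map f (n + 1) ∘ₗ subdivision b (n + 1) = subdivision b' (n + 1) ∘ₗ map f (n + 1)
      from LinearMap.congr_fun h c
    ext w : 2
    simp [subdivision_single, map_cone, ih, hf, map_boundary]

lemma map_subdivisionHomotopy (hf : ∀ n w, f (b n w) = b' n (f ∘ w)) (n : ℕ)
    (c : OrderedChain k V n) :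
    map f (n + 1) (subdivisionHomotopy b n c) = subdivisionHomotopy b' n (map f n c) := by
  induction n with
  | zero => simp [subdivisionHomotopy]
  | succ n ih =>
    suffices h : map f (n + 2) ∘ₗ subdivisionHomotopy b (n + 1) =
      subdivisionHomotopy b' (n + 1) ∘ₗ map f (n + 1) from LinearMap.congr_fun h c
    ext w : 2
    simp [subdivisionHomotopy_single, map_cone, ih, hf, map_boundary, -cone_single]

end OrderedChain

section AffineSimplex

variable {E : Type*} [SeminormedAddCommGroup E] [NormedSpace ℝ E] {s : Set E} {n : ℕ}

/-- The affine simplex in a convex set with given vertices. -/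
def affineSimplex (hs : Convex ℝ s) (w : Fin n → s) : C(stdSimplex ℝ (Fin n), s) where
  toFun p := ⟨∑ i, p.1 i • (w i : E), hs.sum_mem (fun i _ => p.2.1 i) p.2.2 fun i _ => (w i).2⟩
  continuous_toFun := by
    refine Continuous.subtype_mk (continuous_finsetSum _ fun i _ => ?_) _
    exact ((continuous_apply i).comp continuous_subtype_val).smul continuous_const

lemma affineSimplex_coe (hs : Convex ℝ s) (w : Fin n → s) (p : stdSimplex ℝ (Fin n)) :
    (affineSimplex hs w p : E) = ∑ i, p.1 i • (w i : E) := rfl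

lemma affineSimplex_coe_mem (hs : Convex ℝ s) (w : Fin n → s) (p : stdSimplex ℝ (Fin n)) {t : Set E}
    (ht : Convex ℝ t) (hw : ∀ i, (w i : E) ∈ t) : (affineSimplex hs w p : E) ∈ t :=
  ht.sum_mem (fun i _ => p.2.1 i) p.2.2 fun i _ => hw i

lemma affineSimplex_comp_affineSimplex (hs : Convex ℝ s) (w : Fin n → s) {m : ℕ}
    (u : Fin m → stdSimplex ℝ (Fin n)) :
    (affineSimplex hs w).comp (affineSimplex (convex_stdSimplex ℝ (Fin n)) u) =
      affineSimplex hs (affineSimplex hs w ∘ u) := by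
  ext p
  simp only [ContinuousMap.comp_apply, affineSimplex_coe, Function.comp_apply, Finset.sum_apply,
    Pi.smul_apply, smul_eq_mul, Finset.sum_smul, Finset.smul_sum, mul_smul]
  exact Finset.sum_comm

lemma affineSimplex_comp_vertex (hs : Convex ℝ s) (w : Fin n → s) :
    affineSimplex hs w ∘ stdSimplex.vertex = w := by
  ext i
  simp [affineSimplex_coe, Pi.single_apply]

lemma affineSimplex_vertex :
    affineSimplex (convex_stdSimplex ℝ (Fin n)) stdSimplex.vertex = .id _ := by
  ext p i
  change (affineSimplex (convex_stdSimplex ℝ (Fin n)) stdSimplex.vertex p).1 i = p.1 i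
  simp [affineSimplex_coe, Pi.single_apply]

lemma affineSimplex_vertex_comp {m : ℕ} (f : Fin m → Fin n) :
    affineSimplex (convex_stdSimplex ℝ (Fin n)) (stdSimplex.vertex ∘ f) =
      ⟨stdSimplex.map f, stdSimplex.continuous_map f⟩ := by
  ext p i
  change (affineSimplex (convex_stdSimplex ℝ (Fin n)) (stdSimplex.vertex ∘ f) p).1 i =
    FunOnFinite.linearMap ℝ ℝ f p.1 i
  simp [affineSimplex_coe, Pi.single_apply, FunOnFinite.linearMap_apply_apply, Finset.sum_filter,
    eq_comm]

/-- The barycenter of the vertices of an affine simplex. -/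
noncomputable def vertexBarycenter (hs : Convex ℝ s) (n : ℕ) (w : Fin (n + 1) → s) : s :=
  affineSimplex hs w stdSimplex.barycenter

lemma affineSimplex_vertexBarycenter (hs : Convex ℝ s) (w : Fin n → s) (m : ℕ)
    (u : Fin (m + 1) → stdSimplex ℝ (Fin n)) :
    affineSimplex hs w (vertexBarycenter (convex_stdSimplex ℝ (Fin n)) m u) =
      vertexBarycenter hs m (affineSimplex hs w ∘ u) :=
  DFunLike.congr_fun (affineSimplex_comp_affineSimplex hs w u) stdSimplex.barycenter

lemma vertexBarycenter_coe (hs : Convex ℝ s) (w : Fin (n + 1) → s) :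
    (vertexBarycenter hs n w : E) = (n + 1 : ℝ)⁻¹ • ∑ i, (w i : E) := by
  simp [vertexBarycenter, affineSimplex_coe, Finset.smul_sum]

lemma dist_vertexBarycenter_le (hs : Convex ℝ s) (w : Fin (n + 1) → s) {D : ℝ}
    (hD : ∀ i j, dist (w i) (w j) ≤ D) (j : Fin (n + 1)) :
    dist (w j) (vertexBarycenter hs n w) ≤ n / (n + 1) * D := by
  have hsub : (w j : E) - vertexBarycenter hs n w =
      (n + 1 : ℝ)⁻¹ • ∑ i ∈ Finset.univ.erase j, ((w j : E) - w i) := by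
    rw [Finset.sum_erase _ (sub_self _), Finset.sum_sub_distrib, vertexBarycenter_coe,
      Finset.sum_const, Finset.card_fin, smul_sub, ← Nat.cast_smul_eq_nsmul ℝ,
      smul_smul]
    push_cast
    rw [inv_mul_cancel₀ (by positivity), one_smul]
  have hsum : ‖∑ i ∈ Finset.univ.erase j, ((w j : E) - w i)‖ ≤ n * D := by
    simpa using norm_sum_le_of_le (Finset.univ.erase j) fun i _ =>
      (dist_eq_norm (w j : E) (w i)).symm.trans_le (hD j i)
  rw [Subtype.dist_eq, dist_eq_norm, hsub, norm_smul, Real.norm_of_nonneg (by positivity),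
    div_mul_eq_mul_div, div_eq_inv_mul]
  gcongr

end AffineSimplex

section Mesh

variable {E : Type*} [PseudoMetricSpace E] {s : Set E} {n : ℕ}

/-- Tuples of points of `s` lying in the set `t` and having pairwise distances at most `D`. -/
def tuplesOfMeshLE (s t : Set E) (n : ℕ) (D : ℝ) : Set (Fin n → s) :=
  {u | (∀ i, (u i : E) ∈ t) ∧ ∀ i j, dist (u i) (u j) ≤ D}

lemma tuplesOfMeshLE_mono {t t' : Set E} (ht : t ⊆ t') {D D' : ℝ} (hD : D ≤ D') :
    tuplesOfMeshLE s t n D ⊆ tuplesOfMeshLE s t' n D' :=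
  fun _ hu => ⟨fun i => ht (hu.1 i), fun i j => (hu.2 i j).trans hD⟩

lemma cons_mem_tuplesOfMeshLE {t : Set E} {D : ℝ} {b : s} {u : Fin n → s}
    (hu : u ∈ tuplesOfMeshLE s t n D) (hb : (b : E) ∈ t) (hD : 0 ≤ D)
    (hbu : ∀ i, dist (u i) b ≤ D) :
    (Fin.cons b u : Fin (n + 1) → s) ∈ tuplesOfMeshLE s t (n + 1) D := by
  refine ⟨Fin.cases hb hu.1, Fin.cases (Fin.cases ?_ fun j => ?_) fun i => Fin.cases ?_ fun j => ?_⟩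
  · simpa using hD
  · simpa [dist_comm] using hbu j
  · simpa using hbu i
  · simpa using hu.2 i j

end Mesh

namespace OrderedChain

variable {E : Type*} [SeminormedAddCommGroup E] [NormedSpace ℝ E] {s : Set E}
variable {k : Type*} [CommRing k]

lemma cone_mem_supported {V : Type*} {n : ℕ} {A : Set (Fin n → V)} {B : Set (Fin (n + 1) → V)}
    {v : V} (h : ∀ u ∈ A, (Fin.cons v u : Fin (n + 1) → V) ∈ B) {c : OrderedChain k V n}
    (hc : c ∈ Finsupp.supported k k A) : cone v n c ∈ Finsupp.supported k k B := by
  have himage := Submodule.mem_map_of_mem (f := cone v n) hc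
  rw [cone, Finsupp.lmapDomain_supported] at himage
  exact Finsupp.supported_mono (Set.image_subset_iff.2 h) himage

lemma subdivision_single_mem_supported (hs : Convex ℝ s) {N n : ℕ} (hn : n ≤ N + 1) (w : Fin n → s)
    {D : ℝ} (hD₀ : 0 ≤ D) (hD : ∀ i j, dist (w i) (w j) ≤ D) :
    subdivision (vertexBarycenter hs) n (.single w (1 : k)) ∈ Finsupp.supported k k
      (tuplesOfMeshLE s (convexHull ℝ (Set.range fun j => (w j : E))) n (N / (N + 1) * D)) := by
  induction n with
  | zero => exact fun u _ => ⟨fun i => i.elim0, fun i => i.elim0⟩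
  | succ n ih =>
    rw [subdivision_single, boundary_single, map_sum]
    set t := convexHull ℝ (Set.range fun j => (w j : E))
    have hwt (i : Fin (n + 1)) : (w i : E) ∈ t := subset_convexHull ℝ _ ⟨i, rfl⟩
    have hfaces : ∑ i : Fin (n + 1), subdivision (vertexBarycenter hs) n
        ((-1) ^ (i : ℕ) • .single (w ∘ i.succAbove) (1 : k)) ∈
          Finsupp.supported k k (tuplesOfMeshLE s t n (N / (N + 1) * D)) := by
      refine sum_mem fun i _ => ?_
      rw [map_zsmul]
      refine zsmul_mem (Finsupp.supported_mono (tuplesOfMeshLE_mono (convexHull_mono ?_) le_rfl)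
        (ih (by lia) (w ∘ i.succAbove) fun a b => hD _ _)) _
      exact Set.range_comp_subset_range i.succAbove fun j => (w j : E)
    have hball : t ⊆ Metric.closedBall (vertexBarycenter hs n w : E) (N / (N + 1) * D) := by
      refine convexHull_min (Set.range_subset_iff.2 fun j => ?_) (convex_closedBall _ _)
      refine (dist_vertexBarycenter_le hs w hD j).trans ?_
      gcongr ?_ * D
      have hnN : (n : ℝ) ≤ N := by exact_mod_cast Nat.le_of_succ_le_succ hn
      rw [div_le_div_iff₀ (by positivity) (by positivity)]
      linarith
    exact cone_mem_supported (fun u hu => cons_mem_tuplesOfMeshLE hu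
      (affineSimplex_coe_mem hs w _ (convex_convexHull ℝ _) hwt) (by positivity)
      fun i => hball (hu.1 i)) hfaces

lemma subdivision_mem_supported (hs : Convex ℝ s) {n : ℕ} {D : ℝ} (hD : 0 ≤ D)
    {c : OrderedChain k s (n + 1)}
    (hc : c ∈ Finsupp.supported k k (tuplesOfMeshLE s Set.univ (n + 1) D)) :
    subdivision (vertexBarycenter hs) (n + 1) c ∈ Finsupp.supported k k
      (tuplesOfMeshLE s Set.univ (n + 1) (n / (n + 1) * D)) := by
  rw [← c.sum_single, Finsupp.sum, map_sum]
  refine sum_mem fun u hu => ?_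
  rw [← Finsupp.smul_single_one, map_smul]
  exact Submodule.smul_mem _ _ (Finsupp.supported_mono
    (tuplesOfMeshLE_mono (Set.subset_univ _) le_rfl)
    (subdivision_single_mem_supported hs le_rfl u hD (hc hu).2))

lemma subdivision_pow_mem_supported (hs : Convex ℝ s) {n : ℕ} {D : ℝ} (hD : 0 ≤ D)
    {c : OrderedChain k s (n + 1)}
    (hc : c ∈ Finsupp.supported k k (tuplesOfMeshLE s Set.univ (n + 1) D)) (M : ℕ) :
    (subdivision (vertexBarycenter hs) (n + 1) ^ M) c ∈ Finsupp.supported k k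
      (tuplesOfMeshLE s Set.univ (n + 1) ((n / (n + 1)) ^ M * D)) := by
  induction M with
  | zero => simpa using hc
  | succ M ih =>
    rw [pow_succ', pow_succ', mul_assoc]
    exact subdivision_mem_supported hs (by positivity) ih

end OrderedChain

open scoped Simplicial

section SingularComplex

variable (k : Type u) [CommRing k]

open scoped Classical in
/-- The basis of the simplicial chains given by the simplices; Mathlib defines the chains as an
abstract coproduct of copies of `k`. -/
noncomputable def simplicialBasis (S : SSet.{0}) (n : ℕ) :
    Module.Basis (S _⦋n⦌) k ((S.chainComplex (ModuleCat.of k k)).X n) :=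
  .ofRepr ((ModuleCat.coprodIsoDirectSum fun _ : S _⦋n⦌ => ModuleCat.of k k).toLinearEquiv ≪≫ₗ
    (finsuppLEquivDirectSum k k (S _⦋n⦌)).symm)

lemma simplicialBasis_apply (S : SSet.{0}) (n : ℕ) (x : S _⦋n⦌) :
    simplicialBasis k S n x = (S.ιChainComplex x : ModuleCat.of k k ⟶ _).hom (1 : k) := by
  classical
  refine (simplicialBasis k S n).repr.injective ((Module.Basis.repr_self ..).trans ?_)
  have h := ConcreteCategory.congr_hom (ModuleCat.ι_coprodIsoDirectSum_hom
    (fun _ : S _⦋n⦌ => ModuleCat.of k k) x) (1 : k)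
  refine Eq.symm ((congrArg (finsuppLEquivDirectSum k k (S _⦋n⦌)).symm h).trans ?_)
  exact finsuppLEquivDirectSum_symm_lof ..

lemma d_simplicialBasis (S : SSet.{0}) (n : ℕ) (x : S _⦋n + 1⦌) :
    (S.chainComplex (ModuleCat.of k k)).d (n + 1) n (simplicialBasis k S (n + 1) x) =
      ∑ i : Fin (n + 2), (-1) ^ (i : ℕ) • simplicialBasis k S n (S.δ i x) := by
  simp only [simplicialBasis_apply]
  have h := ConcreteCategory.congr_hom (S.ιChainComplex_d (R := ModuleCat.of k k) x) (1 : k)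
  refine h.trans ?_
  change (∑ i : Fin (n + 2), ((-1) ^ (i : ℕ) • S.ιChainComplex (S.δ i x) :
    ModuleCat.of k k ⟶ (S.chainComplex (ModuleCat.of k k)).X n)).hom (1 : k) = _
  rw [ModuleCat.hom_sum, LinearMap.sum_apply]
  rfl

lemma chainComplexMap_simplicialBasis {S T : SSet.{0}} (f : S ⟶ T) (n : ℕ) (x : S _⦋n⦌) :
    (SSet.chainComplexMap f (ModuleCat.of k k)).f n (simplicialBasis k S n x) =
      simplicialBasis k T n (f.app _ x) := by
  simp only [simplicialBasis_apply]
  exact ConcreteCategory.congr_hom (S.ι_chainComplexMap_f (R := ModuleCat.of k k) T f x) (1 : k)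

variable (X : Type) [TopologicalSpace X] {Y : Type} [TopologicalSpace Y]

/-- The singular chain complex of `X` with coefficients in `k`. -/
noncomputable abbrev singularComplex : ChainComplex (ModuleCat.{u} k) ℕ :=
  (TopCat.toSSet.obj (TopCat.of X)).chainComplex (ModuleCat.of k k)

/-- The basis of the singular chains given by the singular simplices. -/
noncomputable def singularBasis (n : ℕ) :
    Module.Basis C(stdSimplex ℝ (Fin (n + 1)), X) k ((singularComplex k X).X n) :=
  (simplicialBasis k _ n).reindex (TopCat.toSSetObjEquiv (TopCat.of X) (op ⦋n⦌))

variable {X}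

lemma d_singularBasis (n : ℕ) (σ : C(stdSimplex ℝ (Fin (n + 2)), X)) :
    (singularComplex k X).d (n + 1) n (singularBasis k X (n + 1) σ) =
      ∑ i : Fin (n + 2), (-1) ^ (i : ℕ) • singularBasis k X n
        (σ.comp ⟨stdSimplex.map i.succAbove, stdSimplex.continuous_map _⟩) := by
  simp only [singularBasis, Module.Basis.reindex_apply]
  exact d_simplicialBasis ..

variable {k} in
/-- The chain map induced by a continuous map. -/
noncomputable abbrev singularMap (f : C(X, Y)) : singularComplex k X ⟶ singularComplex k Y :=
  SSet.chainComplexMap (TopCat.toSSet.map (TopCat.ofHom f)) (ModuleCat.of k k)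

lemma singularMap_singularBasis (f : C(X, Y)) (n : ℕ) (σ : C(stdSimplex ℝ (Fin (n + 1)), X)) :
    (singularMap f).f n (singularBasis k X n σ) = singularBasis k Y n (f.comp σ) := by
  simp only [singularBasis, Module.Basis.reindex_apply]
  exact chainComplexMap_simplicialBasis ..

end SingularComplex

section Subdivision

variable {k : Type u} [CommRing k] {X : Type} [TopologicalSpace X] {Y : Type} [TopologicalSpace Y]
  {N n m : ℕ}

/-- The singular chain obtained from a chain of affine simplices in a standard simplex by composing
each of them with `σ`. -/
noncomputable def realize (σ : C(stdSimplex ℝ (Fin N), X)) (n : ℕ) :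
    OrderedChain k (stdSimplex ℝ (Fin N)) (n + 1) →ₗ[k] (singularComplex k X).X n :=
  Finsupp.linearCombination k fun w =>
    singularBasis k X n (σ.comp (affineSimplex (convex_stdSimplex ℝ (Fin N)) w))

lemma realize_single (σ : C(stdSimplex ℝ (Fin N), X)) (w : Fin (n + 1) → stdSimplex ℝ (Fin N)) :
    realize (k := k) σ n (.single w 1) =
      singularBasis k X n (σ.comp (affineSimplex (convex_stdSimplex ℝ (Fin N)) w)) := by
  simp [realize]

lemma realize_vertex (σ : C(stdSimplex ℝ (Fin (n + 1)), X)) :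
    realize (k := k) σ n (.single stdSimplex.vertex 1) = singularBasis k X n σ := by
  rw [realize_single, affineSimplex_vertex, ContinuousMap.comp_id]

lemma d_realize (σ : C(stdSimplex ℝ (Fin N), X))
    (c : OrderedChain k (stdSimplex ℝ (Fin N)) (n + 2)) :
    (singularComplex k X).d (n + 1) n (realize σ (n + 1) c) =
      realize σ n (OrderedChain.boundary (n + 1) c) := by
  suffices h : ((singularComplex k X).d (n + 1) n).hom ∘ₗ realize σ (n + 1) =
      realize σ n ∘ₗ OrderedChain.boundary (n + 1) from LinearMap.congr_fun h c
  ext w : 2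
  simp only [LinearMap.comp_apply, Finsupp.lsingle_apply, realize_single, d_singularBasis,
    OrderedChain.boundary_single, map_sum, map_zsmul, ContinuousMap.comp_assoc,
    ← affineSimplex_vertex_comp, affineSimplex_comp_affineSimplex, ← Function.comp_assoc,
    affineSimplex_comp_vertex]

lemma realize_map (σ : C(stdSimplex ℝ (Fin N), X)) (w : Fin m → stdSimplex ℝ (Fin N))
    (c : OrderedChain k (stdSimplex ℝ (Fin m)) (n + 1)) :
    realize σ n (OrderedChain.map (affineSimplex (convex_stdSimplex ℝ (Fin N)) w) (n + 1) c) =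
      realize (σ.comp (affineSimplex (convex_stdSimplex ℝ (Fin N)) w)) n c := by
  suffices h : realize σ n ∘ₗ
      OrderedChain.map (affineSimplex (convex_stdSimplex ℝ (Fin N)) w) (n + 1) =
      realize (k := k) (σ.comp (affineSimplex (convex_stdSimplex ℝ (Fin N)) w)) n from
    LinearMap.congr_fun h c
  ext u : 2
  simp only [LinearMap.comp_apply, Finsupp.lsingle_apply, OrderedChain.map_single, realize_single,
    ContinuousMap.comp_assoc, affineSimplex_comp_affineSimplex]

/-- The operator on singular chains applying a fixed chain of affine simplices to every singular
simplex. -/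
noncomputable def affineOperator (X : Type) [TopologicalSpace X]
    (a : OrderedChain k (stdSimplex ℝ (Fin (n + 1))) (m + 1)) :
    (singularComplex k X).X n →ₗ[k] (singularComplex k X).X m :=
  (singularBasis k X n).constr k fun σ => realize σ m a

lemma affineOperator_singularBasis (a : OrderedChain k (stdSimplex ℝ (Fin (n + 1))) (m + 1))
    (σ : C(stdSimplex ℝ (Fin (n + 1)), X)) :
    affineOperator X a (singularBasis k X n σ) = realize σ m a := by
  simp [affineOperator]

variable (k X) in
/-- Barycentric subdivision of singular chains. -/
noncomputable def singularSubdivision (n : ℕ) :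
    (singularComplex k X).X n →ₗ[k] (singularComplex k X).X n :=
  affineOperator X (OrderedChain.subdivision (vertexBarycenter (convex_stdSimplex ℝ _)) (n + 1)
    (.single stdSimplex.vertex 1))

variable (k X) in
/-- The chain homotopy between the identity and barycentric subdivision. -/
noncomputable def singularSubdivisionHomotopy (n : ℕ) :
    (singularComplex k X).X n →ₗ[k] (singularComplex k X).X (n + 1) :=
  affineOperator X (OrderedChain.subdivisionHomotopy (vertexBarycenter (convex_stdSimplex ℝ _))
    (n + 1) (.single stdSimplex.vertex 1))

lemma singularSubdivision_realize (σ : C(stdSimplex ℝ (Fin N), X))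
    (c : OrderedChain k (stdSimplex ℝ (Fin N)) (n + 1)) :
    singularSubdivision k X n (realize σ n c) =
      realize σ n
        (OrderedChain.subdivision (vertexBarycenter (convex_stdSimplex ℝ _)) (n + 1) c) := by
  suffices h : singularSubdivision k X n ∘ₗ realize σ n = realize σ n ∘ₗ
      OrderedChain.subdivision (vertexBarycenter (convex_stdSimplex ℝ _)) (n + 1) from
    LinearMap.congr_fun h c
  ext w : 2
  simp only [LinearMap.comp_apply, Finsupp.lsingle_apply, realize_single, singularSubdivision,
    affineOperator_singularBasis, ← realize_map]
  rw [OrderedChain.map_subdivision (affineSimplex_vertexBarycenter _ w), OrderedChain.map_single,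
    affineSimplex_comp_vertex]

lemma singularSubdivisionHomotopy_realize (σ : C(stdSimplex ℝ (Fin N), X))
    (c : OrderedChain k (stdSimplex ℝ (Fin N)) (n + 1)) :
    singularSubdivisionHomotopy k X n (realize σ n c) =
      realize σ (n + 1) (OrderedChain.subdivisionHomotopy
        (vertexBarycenter (convex_stdSimplex ℝ _)) (n + 1) c) := by
  suffices h : singularSubdivisionHomotopy k X n ∘ₗ realize σ n = realize σ (n + 1) ∘ₗ
      OrderedChain.subdivisionHomotopy (vertexBarycenter (convex_stdSimplex ℝ _)) (n + 1) from
    LinearMap.congr_fun h c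
  ext w : 2
  simp only [LinearMap.comp_apply, Finsupp.lsingle_apply, realize_single,
    singularSubdivisionHomotopy, affineOperator_singularBasis, ← realize_map]
  rw [OrderedChain.map_subdivisionHomotopy (affineSimplex_vertexBarycenter _ w),
    OrderedChain.map_single, affineSimplex_comp_vertex]

lemma d_singularSubdivisionHomotopy_zero (c : (singularComplex k X).X 0) :
    (singularComplex k X).d 1 0 (singularSubdivisionHomotopy k X 0 c) =
      c - singularSubdivision k X 0 c := by
  suffices h : ((singularComplex k X).d 1 0).hom ∘ₗ singularSubdivisionHomotopy k X 0 =
      LinearMap.id - singularSubdivision k X 0 from LinearMap.congr_fun h c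
  refine (singularBasis k X 0).ext fun σ => ?_
  rw [← realize_vertex]
  simp only [LinearMap.comp_apply, LinearMap.sub_apply, LinearMap.id_apply,
    singularSubdivisionHomotopy_realize, singularSubdivision_realize, d_realize,
    OrderedChain.boundary_subdivisionHomotopy, map_sub]
  simp [OrderedChain.subdivisionHomotopy]

lemma d_singularSubdivisionHomotopy_succ (c : (singularComplex k X).X (n + 1)) :
    (singularComplex k X).d (n + 2) (n + 1) (singularSubdivisionHomotopy k X (n + 1) c) =
      c - singularSubdivision k X (n + 1) c -
        singularSubdivisionHomotopy k X n ((singularComplex k X).d (n + 1) n c) := by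
  suffices h : ((singularComplex k X).d (n + 2) (n + 1)).hom ∘ₗ
        singularSubdivisionHomotopy k X (n + 1) =
      LinearMap.id - singularSubdivision k X (n + 1) -
        singularSubdivisionHomotopy k X n ∘ₗ ((singularComplex k X).d (n + 1) n).hom from
    LinearMap.congr_fun h c
  refine (singularBasis k X (n + 1)).ext fun σ => ?_
  rw [← realize_vertex]
  simp only [LinearMap.comp_apply, LinearMap.sub_apply, LinearMap.id_apply,
    singularSubdivisionHomotopy_realize, singularSubdivision_realize, d_realize,
    OrderedChain.boundary_subdivisionHomotopy, map_sub]

variable (k) in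
/-- The submodule of chains whose simplices each lie in a member of the family `𝒰`. -/
noncomputable def smallChains (𝒰 : Set (Set X)) (n : ℕ) : Submodule k ((singularComplex k X).X n) :=
  .span k (singularBasis k X n '' {σ | ∃ U ∈ 𝒰, Set.range σ ⊆ U})

variable {𝒰 : Set (Set X)}

lemma realize_mem_smallChains {σ : C(stdSimplex ℝ (Fin N), X)}
    {c : OrderedChain k (stdSimplex ℝ (Fin N)) (n + 1)}
    (hc : c ∈ Finsupp.supported k k {w | ∃ U ∈ 𝒰,
      Set.range (σ.comp (affineSimplex (convex_stdSimplex ℝ (Fin N)) w)) ⊆ U}) :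
    realize σ n c ∈ smallChains k 𝒰 n := by
  rw [realize, Finsupp.linearCombination_apply]
  exact Submodule.sum_mem _ fun w hw => Submodule.smul_mem _ _ <|
    Submodule.subset_span ⟨_, hc hw, rfl⟩

lemma affineOperator_mem_smallChains
    (a : OrderedChain k (stdSimplex ℝ (Fin (n + 1))) (m + 1)) {c : (singularComplex k X).X n}
    (hc : c ∈ smallChains k 𝒰 n) : affineOperator X a c ∈ smallChains k 𝒰 m := by
  suffices h : smallChains k 𝒰 n ≤ (smallChains k 𝒰 m).comap (affineOperator X a) from h hc
  refine Submodule.span_le.2 ?_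
  rintro _ ⟨σ, ⟨U, hU, hσ⟩, rfl⟩
  rw [SetLike.mem_coe, Submodule.mem_comap, affineOperator_singularBasis]
  exact realize_mem_smallChains fun w _ => ⟨U, hU, (Set.range_comp_subset_range _ σ).trans hσ⟩

lemma d_mem_smallChains {c : (singularComplex k X).X n} (hc : c ∈ smallChains k 𝒰 n) (j : ℕ) :
    (singularComplex k X).d n j c ∈ smallChains k 𝒰 j := by
  by_cases hj : (ComplexShape.down ℕ).Rel n j
  swap
  · rw [(singularComplex k X).shape n j hj]
    exact zero_mem _
  obtain rfl : j + 1 = n := hj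
  suffices h : smallChains k 𝒰 (j + 1) ≤
    (smallChains k 𝒰 j).comap ((singularComplex k X).d (j + 1) j).hom from h hc
  refine Submodule.span_le.2 ?_
  rintro _ ⟨σ, ⟨U, hU, hσ⟩, rfl⟩
  rw [SetLike.mem_coe, Submodule.mem_comap, d_singularBasis]
  refine Submodule.sum_mem _ fun i _ => zsmul_mem (Submodule.subset_span ?_) _
  exact ⟨_, ⟨U, hU, (Set.range_comp_subset_range _ σ).trans hσ⟩, rfl⟩

lemma sub_singularSubdivision_sub_d_mem_smallChains {c : (singularComplex k X).X n}
    (hc : ∀ j, (singularComplex k X).d n j c ∈ smallChains k 𝒰 j) :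
    c - singularSubdivision k X n c -
      (singularComplex k X).d (n + 1) n (singularSubdivisionHomotopy k X n c) ∈
        smallChains k 𝒰 n := by
  cases n with
  | zero =>
    rw [d_singularSubdivisionHomotopy_zero, sub_self]
    exact zero_mem _
  | succ n =>
    rw [d_singularSubdivisionHomotopy_succ, sub_sub_cancel]
    exact affineOperator_mem_smallChains _ (hc n)

lemma d_singularSubdivision_mem_smallChains {c : (singularComplex k X).X n}
    (hc : ∀ j, (singularComplex k X).d n j c ∈ smallChains k 𝒰 j) (j : ℕ) :
    (singularComplex k X).d n j (singularSubdivision k X n c) ∈ smallChains k 𝒰 j := by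
  have h := d_mem_smallChains (sub_singularSubdivision_sub_d_mem_smallChains hc) j
  rw [map_sub, map_sub, ← ModuleCat.comp_apply, HomologicalComplex.d_comp_d] at h
  simpa using sub_mem (hc j) h

lemma singularSubdivision_pow_realize (σ : C(stdSimplex ℝ (Fin N), X))
    (c : OrderedChain k (stdSimplex ℝ (Fin N)) (n + 1)) (M : ℕ) :
    (singularSubdivision k X n ^ M) (realize σ n c) = realize σ n
      ((OrderedChain.subdivision (vertexBarycenter (convex_stdSimplex ℝ _)) (n + 1) ^ M) c) := by
  induction M with
  | zero => rfl
  | succ M ih =>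
    rw [pow_succ', pow_succ', Module.End.mul_apply, Module.End.mul_apply, ih,
      singularSubdivision_realize]

lemma singularSubdivision_pow_mem_smallChains {c : (singularComplex k X).X n}
    (hc : c ∈ smallChains k 𝒰 n) (M : ℕ) :
    (singularSubdivision k X n ^ M) c ∈ smallChains k 𝒰 n :=
  Module.End.pow_apply_mem_of_forall_mem M (fun _ => affineOperator_mem_smallChains _) _ hc

variable (hU : ∀ U ∈ 𝒰, IsOpen U) (hcover : ⋃₀ 𝒰 = Set.univ)
include hU hcover

lemma exists_range_comp_affineSimplex_subset (σ : C(stdSimplex ℝ (Fin N), X)) :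
    ∃ δ > 0, ∀ n, ∀ w ∈ tuplesOfMeshLE (stdSimplex ℝ (Fin N)) Set.univ (n + 1) δ,
      ∃ U ∈ 𝒰, Set.range (σ.comp (affineSimplex (convex_stdSimplex ℝ (Fin N)) w)) ⊆ U := by
  obtain ⟨δ, hδ, hball⟩ := lebesgue_number_lemma_of_metric_sUnion (c := (σ ⁻¹' ·) '' 𝒰)
    (isCompact_univ (X := stdSimplex ℝ (Fin N)))
    (Set.forall_mem_image.2 fun U h => (hU U h).preimage σ.continuous)
    (by rw [Set.sUnion_image, ← Set.preimage_sUnion, hcover, Set.preimage_univ])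
  refine ⟨δ / 2, half_pos hδ, fun n w hw => ?_⟩
  obtain ⟨_, ⟨U, h, rfl⟩, hsub⟩ := hball (w 0) trivial
  refine ⟨U, h, ?_⟩
  rintro _ ⟨p, rfl⟩
  refine hsub (lt_of_le_of_lt ?_ (half_lt_self hδ))
  exact affineSimplex_coe_mem _ w p (convex_closedBall (w 0 : Fin N → ℝ) (δ / 2))
    fun i => hw.2 i 0

lemma exists_singularSubdivision_pow_singularBasis_mem (σ : C(stdSimplex ℝ (Fin (n + 1)), X)) :
    ∃ M, (singularSubdivision k X n ^ M) (singularBasis k X n σ) ∈ smallChains k 𝒰 n := by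
  obtain ⟨δ, hδ, hsmall⟩ := exists_range_comp_affineSimplex_subset hU hcover σ
  let D : ℝ := Metric.diam (stdSimplex ℝ (Fin (n + 1)))
  obtain ⟨M, hM⟩ : ∃ M : ℕ, ((n : ℝ) / (n + 1)) ^ M * D < δ := by
    have hlim := (tendsto_pow_atTop_nhds_zero_of_lt_one (r := (n : ℝ) / (n + 1)) (by positivity)
      ((div_lt_one (by positivity)).2 (lt_add_one _))).mul_const D
    rw [zero_mul] at hlim
    exact (hlim.eventually (gt_mem_nhds hδ)).exists
  refine ⟨M, ?_⟩
  rw [← realize_vertex, singularSubdivision_pow_realize]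
  refine realize_mem_smallChains (Finsupp.supported_mono (fun w hw =>
    hsmall n w (tuplesOfMeshLE_mono subset_rfl hM.le hw))
    (OrderedChain.subdivision_pow_mem_supported _ Metric.diam_nonneg
      (Finsupp.single_mem_supported k _ ⟨fun _ => trivial, fun i j => ?_⟩) M))
  exact Metric.dist_le_diam_of_mem (bounded_stdSimplex (Fin (n + 1))) (Subtype.coe_prop _)
    (Subtype.coe_prop _)

lemma exists_singularSubdivision_pow_mem (c : (singularComplex k X).X n) :
    ∃ M, (singularSubdivision k X n ^ M) c ∈ smallChains k 𝒰 n := by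
  induction (singularBasis k X n).mem_span c using Submodule.span_induction with
  | mem _ h =>
    obtain ⟨σ, rfl⟩ := h
    exact exists_singularSubdivision_pow_singularBasis_mem hU hcover σ
  | zero => exact ⟨0, zero_mem _⟩
  | add x y _ _ hx hy =>
    obtain ⟨M, hM⟩ := hx
    obtain ⟨N, hN⟩ := hy
    refine ⟨M + N, ?_⟩
    rw [map_add]
    refine add_mem ?_ ?_
    · rw [add_comm, pow_add]
      exact singularSubdivision_pow_mem_smallChains hM N
    · rw [pow_add]
      exact singularSubdivision_pow_mem_smallChains hN M
  | smul a x _ hx =>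
    obtain ⟨M, hM⟩ := hx
    exact ⟨M, by simpa only [map_smul] using Submodule.smul_mem _ a hM⟩

lemma exists_sub_d_mem_smallChains {c : (singularComplex k X).X n}
    (hc : ∀ j, (singularComplex k X).d n j c ∈ smallChains k 𝒰 j) :
    ∃ e, c - (singularComplex k X).d (n + 1) n e ∈ smallChains k 𝒰 n := by
  obtain ⟨M, hM⟩ := exists_singularSubdivision_pow_mem hU hcover c
  induction M generalizing c with
  | zero => exact ⟨0, by simpa using hM⟩
  | succ M ih =>
    obtain ⟨e, he⟩ := ih (d_singularSubdivision_mem_smallChains hc)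
      (by rwa [pow_succ, Module.End.mul_apply] at hM)
    refine ⟨e + singularSubdivisionHomotopy k X n c, ?_⟩
    have h := add_mem (sub_singularSubdivision_sub_d_mem_smallChains hc) he
    rw [map_add]
    convert h using 1
    abel

end Subdivision

section MayerVietoris

section CommRing

variable {k : Type u} [CommRing k] {X Y : Type} [TopologicalSpace X] [TopologicalSpace Y]

lemma singularMap_comp {Z : Type} [TopologicalSpace Z] (g : C(Y, Z)) (f : C(X, Y)) :
    singularMap (k := k) (g.comp f) = singularMap f ≫ singularMap g := by
  simp [singularMap, SSet.chainComplexMap]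

variable (k X) in
/-- The total singular homology of `X` with coefficients in `k`. -/
noncomputable abbrev SingularHomology : Type u :=
  TotalHomology (singularComplex k X)

variable (k) in
/-- The map induced by `f` in total singular homology. -/
noncomputable abbrev singularHomologyMap (f : C(X, Y)) :
    SingularHomology k X →ₗ[k] SingularHomology k Y :=
  TotalHomology.map (singularMap f)

lemma singularHomologyMap_comp {Z : Type} [TopologicalSpace Z] (g : C(Y, Z)) (f : C(X, Y)) :
    singularHomologyMap k (g.comp f) = singularHomologyMap k g ∘ₗ singularHomologyMap k f := by
  rw [singularHomologyMap, singularMap_comp, TotalHomology.map_comp]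

lemma mono_singularMap_f {f : C(X, Y)} (hf : Function.Injective f) (n : ℕ) :
    Mono ((singularMap (k := k) f).f n) := by
  rw [ModuleCat.mono_iff_injective]
  refine LinearMap.injective_of_linearIndependent (singularBasis k X n).span_eq ?_
  have h : (singularMap f).f n ∘ singularBasis k X n = singularBasis k Y n ∘ f.comp :=
    funext (singularMap_singularBasis k f n)
  rw [h]
  exact (singularBasis k Y n).linearIndependent.comp _ fun σ τ hστ =>
    ContinuousMap.ext fun p => hf (DFunLike.congr_fun hστ p)

lemma range_singularMap_restrict_id (U : Set X) (n : ℕ) :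
    LinearMap.range ((singularMap (k := k) ((ContinuousMap.id X).restrict U)).f n).hom =
      smallChains k {U} n := by
  rw [LinearMap.range_eq_map, ← (singularBasis k U n).span_eq, Submodule.map_span, smallChains,
    ← Set.range_comp]
  congr 1
  ext c
  constructor
  · rintro ⟨σ, rfl⟩
    refine ⟨_, ⟨U, rfl, ?_⟩, (singularMap_singularBasis k _ n σ).symm⟩
    rintro _ ⟨p, rfl⟩
    exact (σ p).2
  · rintro ⟨σ, ⟨_, rfl, hσ⟩, rfl⟩
    exact ⟨⟨fun p => ⟨σ p, hσ ⟨p, rfl⟩⟩, by fun_prop⟩, singularMap_singularBasis ..⟩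

lemma smallChains_singleton_inf_smallChains_singleton (U V : Set X) (n : ℕ) :
    smallChains k {U} n ⊓ smallChains k {V} n = smallChains k {U ∩ V} n := by
  ext c
  simp only [smallChains, Set.mem_singleton_iff, exists_eq_left, Submodule.mem_inf,
    Module.Basis.mem_span_image, ← Set.subset_inter_iff, ← Set.ofPred_and]

lemma smallChains_singleton_sup_smallChains_singleton (U V : Set X) (n : ℕ) :
    smallChains k {U} n ⊔ smallChains k {V} n = smallChains k {U, V} n := by
  rw [smallChains, smallChains, smallChains, ← Submodule.span_union, ← Set.image_union]
  congr 2
  ext σ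
  simp

variable (k) in
/-- The sequence `C(U ∩ V) ⟶ C(U) ⊞ C(V) ⟶ C(X)` of singular chain complexes. -/
noncomputable abbrev mayerVietoris (U V : Set X) :
    ShortComplex (ChainComplex (ModuleCat.{u} k) ℕ) :=
  .mk (biprod.lift (singularMap (.inclusion Set.inter_subset_left))
      (-singularMap (.inclusion Set.inter_subset_right)))
    (biprod.desc (singularMap (.restrict U (.id X))) (singularMap (.restrict V (.id X)))) (by
      rw [biprod.lift_desc, Preadditive.neg_comp, ← singularMap_comp, ← singularMap_comp]
      exact add_neg_cancel _)

variable {U V : Set X}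

instance mono_mayerVietoris_f : Mono (mayerVietoris k U V).f := by
  have h := mono_of_mono_f _ (mono_singularMap_f (k := k)
    (f := .inclusion (Set.inter_subset_left (s := U) (t := V)))
    (Set.inclusion_injective Set.inter_subset_left))
  exact @mono_of_mono_fac _ _ _ _ _ _ _ _ h (biprod.lift_fst _ _)

lemma mayerVietoris_f_f_apply (n : ℕ) (c : (singularComplex k ↥(U ∩ V)).X n) :
    (mayerVietoris k U V).f.f n c =
      (biprod.inl : _ ⟶ (mayerVietoris k U V).X₂).f n
          ((singularMap (.inclusion Set.inter_subset_left)).f n c) -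
        (biprod.inr : _ ⟶ (mayerVietoris k U V).X₂).f n
          ((singularMap (.inclusion Set.inter_subset_right)).f n c) := by
  rw [sub_eq_add_neg, ← map_neg]
  exact ConcreteCategory.congr_hom (HomologicalComplex.congr_hom biprod.lift_eq n) c

lemma mayerVietoris_g_f_apply (n : ℕ) (x : (mayerVietoris k U V).X₂.X n) :
    (mayerVietoris k U V).g.f n x =
      (singularMap (.restrict U (.id X))).f n ((biprod.fst : (mayerVietoris k U V).X₂ ⟶ _).f n x) +
        (singularMap (.restrict V (.id X))).f n
          ((biprod.snd : (mayerVietoris k U V).X₂ ⟶ _).f n x) :=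
  ConcreteCategory.congr_hom (HomologicalComplex.congr_hom biprod.desc_eq n) x

lemma exact_mayerVietoris : (mayerVietoris k U V).Exact := by
  refine exact_of_degreewise_exact _ fun n => ?_
  rw [ShortComplex.moduleCat_exact_iff]
  intro x hx
  let a := (biprod.fst : (mayerVietoris k U V).X₂ ⟶ _).f n x
  let b := (biprod.snd : (mayerVietoris k U V).X₂ ⟶ _).f n x
  have hab : (singularMap (.restrict U (.id X))).f n a =
      -(singularMap (.restrict V (.id X))).f n b :=
    eq_neg_of_add_eq_zero_left ((mayerVietoris_g_f_apply n x).symm.trans hx)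
  obtain ⟨c, hc⟩ : (singularMap (.restrict U (.id X))).f n a ∈ LinearMap.range
      ((singularMap (k := k) (.restrict (U ∩ V) (.id X))).f n).hom := by
    rw [range_singularMap_restrict_id, ← smallChains_singleton_inf_smallChains_singleton,
      ← range_singularMap_restrict_id, ← range_singularMap_restrict_id]
    exact ⟨⟨a, rfl⟩, -b, (map_neg _ _).trans hab.symm⟩
  have hU : (singularMap (.inclusion Set.inter_subset_left)).f n c = a := by
    refine (ModuleCat.mono_iff_injective _).1
      (mono_singularMap_f (f := .restrict U (.id X)) Subtype.val_injective n) ?_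
    rw [← hc, ← ModuleCat.comp_apply, ← HomologicalComplex.comp_f, ← singularMap_comp]
    rfl
  have hV : (singularMap (.inclusion Set.inter_subset_right)).f n c = -b := by
    refine (ModuleCat.mono_iff_injective _).1
      (mono_singularMap_f (f := .restrict V (.id X)) Subtype.val_injective n) ?_
    rw [map_neg, ← hab, ← hc, ← ModuleCat.comp_apply, ← HomologicalComplex.comp_f,
      ← singularMap_comp]
    rfl
  refine ⟨c, (mayerVietoris_f_f_apply n c).trans ?_⟩
  rw [hU, hV, map_neg, sub_neg_eq_add]
  exact ConcreteCategory.congr_hom (HomologicalComplex.congr_hom biprod.total n) x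

lemma range_mayerVietoris_g_f (n : ℕ) :
    LinearMap.range ((mayerVietoris k U V).g.f n).hom = smallChains k {U, V} n := by
  rw [← smallChains_singleton_sup_smallChains_singleton, ← range_singularMap_restrict_id,
    ← range_singularMap_restrict_id]
  refine le_antisymm ?_ (sup_le ?_ ?_)
  · rintro _ ⟨x, rfl⟩
    exact (mayerVietoris_g_f_apply n x).symm ▸ Submodule.add_mem_sup ⟨_, rfl⟩ ⟨_, rfl⟩
  · rintro _ ⟨a, rfl⟩
    exact ⟨_, ConcreteCategory.congr_hom (HomologicalComplex.congr_hom
      (biprod.inl_desc (singularMap (.restrict U (.id X))) (singularMap (.restrict V (.id X))))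
      n) a⟩
  · rintro _ ⟨b, rfl⟩
    exact ⟨_, ConcreteCategory.congr_hom (HomologicalComplex.congr_hom
      (biprod.inr_desc (singularMap (.restrict U (.id X))) (singularMap (.restrict V (.id X))))
      n) b⟩

lemma acyclic_cokernel_mayerVietoris_g (hU : IsOpen U) (hV : IsOpen V) (hUV : U ∪ V = Set.univ) :
    (cokernel (mayerVietoris k U V).g).Acyclic := by
  refine TotalHomology.acyclic_cokernel _ fun n c hc => ?_
  have hsmall (j : ℕ) : (singularComplex k X).d n j c ∈ smallChains k {U, V} j :=
    range_mayerVietoris_g_f (k := k) (U := U) j ▸ hc j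
  obtain ⟨e, he⟩ := exists_sub_d_mem_smallChains (by simp [hU, hV]) (by simpa using hUV) hsmall
  exact ⟨e, (range_mayerVietoris_g_f (k := k) (U := U) n).symm ▸ he⟩

end CommRing

section Field

variable {k : Type u} [Field k] {X Z : Type} [TopologicalSpace X] [TopologicalSpace Z]
  {U V : Set Z} {p : C(Z, X)}

lemma ker_map_mayerVietoris_f
    (hpU : Function.Injective (singularHomologyMap k (p.restrict U)))
    (hpV : Function.Injective (singularHomologyMap k (p.restrict V))) :
    LinearMap.ker (TotalHomology.map (mayerVietoris k U V).f) =
      LinearMap.ker (singularHomologyMap k (p.restrict (U ∩ V))) := by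
  have hleft : LinearMap.ker (singularHomologyMap k (.inclusion Set.inter_subset_left)) =
      LinearMap.ker (singularHomologyMap k (p.restrict (U ∩ V))) := by
    rw [← LinearMap.ker_comp_of_ker_eq_bot _ (LinearMap.ker_eq_bot.2 hpU),
      ← singularHomologyMap_comp]
    rfl
  have hright : LinearMap.ker (singularHomologyMap k (.inclusion Set.inter_subset_right)) =
      LinearMap.ker (singularHomologyMap k (p.restrict (U ∩ V))) := by
    rw [← LinearMap.ker_comp_of_ker_eq_bot _ (LinearMap.ker_eq_bot.2 hpV),
      ← singularHomologyMap_comp]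
    rfl
  have hprod : (TotalHomology.biprodEquiv _ _).toLinearMap ∘ₗ
      TotalHomology.map (mayerVietoris k U V).f =
      (singularHomologyMap k (.inclusion Set.inter_subset_left)).prod
        (-singularHomologyMap k (.inclusion Set.inter_subset_right)) := by
    change LinearMap.prod _ _ ∘ₗ _ = _
    rw [LinearMap.prod_comp, ← TotalHomology.map_comp, ← TotalHomology.map_comp,
      biprod.lift_fst, biprod.lift_snd, TotalHomology.map_neg]
  rw [← LinearEquiv.ker_comp (TotalHomology.biprodEquiv _ _), hprod, LinearMap.ker_prod,
    LinearMap.ker_neg, hleft, hright, inf_idem]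

theorem finite_and_finrank_of_mayerVietoris (hU : IsOpen U) (hV : IsOpen V) (hUV : U ∪ V = Set.univ)
    (hpU : Function.Bijective (singularHomologyMap k (p.restrict U)))
    (hpV : Function.Bijective (singularHomologyMap k (p.restrict V)))
    [Module.Finite k (SingularHomology k X)] [Module.Finite k (SingularHomology k ↥(U ∩ V))] :
    Module.Finite k (SingularHomology k Z) ∧
      Module.finrank k (SingularHomology k Z) +
          2 * Module.finrank k (LinearMap.range (singularHomologyMap k (p.restrict (U ∩ V)))) =
        Module.finrank k (SingularHomology k ↥(U ∩ V)) +
          2 * Module.finrank k (SingularHomology k X) := by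
  let e : TotalHomology (mayerVietoris k U V).X₂ ≃ₗ[k]
      SingularHomology k X × SingularHomology k X :=
    TotalHomology.biprodEquiv _ _ ≪≫ₗ
      .prodCongr (.ofBijective _ hpU) (.ofBijective _ hpV)
  have : Module.Finite k (TotalHomology (mayerVietoris k U V).X₂) := .equiv e.symm
  obtain ⟨hfinite, hfinrank⟩ := TotalHomology.finite_and_finrank_of_exact (k := k)
    exact_mayerVietoris (acyclic_cokernel_mayerVietoris_g hU hV hUV)
  refine ⟨hfinite, ?_⟩
  rw [e.finrank_eq, Module.finrank_prod] at hfinrank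
  have hf := (TotalHomology.map (mayerVietoris k U V).f).finrank_range_add_finrank_ker
  have hp := (singularHomologyMap k (p.restrict (U ∩ V))).finrank_range_add_finrank_ker
  rw [ker_map_mayerVietoris_f hpU.1 hpV.1] at hf
  lia

end Field

end MayerVietoris

section Homotopy

variable {k : Type u} [CommRing k] {X Y : Type} [TopologicalSpace X] [TopologicalSpace Y]

lemma singularHomologyMap_congr {f g : C(X, Y)} (h : f.Homotopic g) :
    singularHomologyMap k f = singularHomologyMap k g := by
  obtain ⟨H⟩ := h
  refine congrArg DirectSum.lmap (funext fun i => congrArg ModuleCat.Hom.hom ?_)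
  exact TopCat.Homotopy.congr_homologyMap_singularChainComplexFunctor
    (f := TopCat.ofHom f) (g := TopCat.ofHom g) H (ModuleCat.of k k) i

lemma singularHomologyMap_id : singularHomologyMap k (.id X) = .id := by
  rw [singularHomologyMap, ← TotalHomology.map_id]
  congr 1
  simp [singularMap, SSet.chainComplexMap]

variable (k) in
/-- The isomorphism in total singular homology induced by a homotopy equivalence. -/
noncomputable def singularHomologyEquiv (e : ContinuousMap.HomotopyEquiv X Y) :
    SingularHomology k X ≃ₗ[k] SingularHomology k Y :=
  .ofLinearMap (singularHomologyMap k e.toFun) (singularHomologyMap k e.invFun)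
    (by rw [← singularHomologyMap_comp, singularHomologyMap_congr e.right_inv,
      singularHomologyMap_id])
    (by rw [← singularHomologyMap_comp, singularHomologyMap_congr e.left_inv,
      singularHomologyMap_id])

lemma range_singularHomologyMap_comp {Z : Type} [TopologicalSpace Z] (f : C(Y, Z))
    (e : ContinuousMap.HomotopyEquiv X Y) :
    LinearMap.range (singularHomologyMap k (f.comp e.toFun)) =
      LinearMap.range (singularHomologyMap k f) := by
  rw [singularHomologyMap_comp]
  exact (singularHomologyEquiv k e).range_comp _

variable (k X) in
open scoped Classical in
/-- The homology of a totally disconnected space is free on its points. -/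
noncomputable def singularHomologyEquivFinsupp [TotallyDisconnectedSpace X] :
    SingularHomology k X ≃ₗ[k] (X →₀ k) :=
  .ofBijective (DirectSum.component k ℕ _ 0) (by
    have (n : ℕ) : Subsingleton ((singularComplex k X).homology (n + 1)) :=
      ModuleCat.subsingleton_of_isZero
        (AlgebraicTopology.isZero_singularHomologyFunctor_of_totallyDisconnectedSpace
          _ (n + 1) (ModuleCat.of k k) (TopCat.of X) n.succ_ne_zero)
    constructor
    · rintro x y hxy
      ext (_ | n)
      · exact hxy
      · exact Subsingleton.elim _ _
    · exact fun x => ⟨DirectSum.lof k ℕ _ 0 x, DirectSum.component.lof_self ..⟩) ≪≫ₗ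
  ((AlgebraicTopology.singularHomologyFunctorZeroOfTotallyDisconnectedSpace _
      (ModuleCat.of k k) (TopCat.of X)).toLinearEquiv ≪≫ₗ
    (ModuleCat.coprodIsoDirectSum fun _ : X => ModuleCat.of k k).toLinearEquiv ≪≫ₗ
      (finsuppLEquivDirectSum k k X).symm)

end Homotopy

section Squeeze

variable {E : Type*} [NormedAddCommGroup E] [InnerProductSpace ℝ E] {e z : E} {y l : ℝ}

/-- Replace the component of `z` along the unit vector `e` by `y` and scale the component orthogonal
to `e` by `√l`. If `1 - y ^ 2 = l * (1 - ⟪e, z⟫ ^ 2)`, then this preserves the unit sphere. -/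
noncomputable def squeeze (e : E) (y l : ℝ) (z : E) : E :=
  y • e + √l • (z - inner ℝ e z • e)

lemma squeeze_inner_one : squeeze e (inner ℝ e z) 1 z = z := by
  simp [squeeze]

lemma squeeze_one_zero : squeeze e 1 0 z = e := by
  simp [squeeze]

lemma inner_squeeze (he : ‖e‖ = 1) : inner ℝ e (squeeze e y l z) = y := by
  simp [squeeze, inner_add_right, inner_sub_right, inner_smul_right, he]

lemma one_sub_norm_squeeze_sq (he : ‖e‖ = 1) (hl : 0 ≤ l)
    (h : 1 - y ^ 2 = l * (1 - inner ℝ e z ^ 2)) :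
    1 - ‖squeeze e y l z‖ ^ 2 = l * (1 - ‖z‖ ^ 2) := by
  have horth : inner ℝ e (z - inner ℝ e z • e) = 0 := by
    simp [inner_sub_right, inner_smul_right, he]
  have hproj : ‖z - inner ℝ e z • e‖ ^ 2 = ‖z‖ ^ 2 - inner ℝ e z ^ 2 := by
    rw [norm_sub_sq_real, inner_smul_right, norm_smul, he, mul_one, Real.norm_eq_abs, sq_abs,
      real_inner_comm]
    ring
  rw [squeeze, norm_add_sq_real, norm_smul, norm_smul, he, mul_one, inner_smul_left,
    inner_smul_right, horth, mul_pow, hproj, Real.norm_eq_abs, Real.norm_eq_abs, sq_abs, sq_abs,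
    Real.sq_sqrt hl]
  linarith

end Squeeze

section FiberDisc

variable {X E : Type} [NormedAddCommGroup E] [InnerProductSpace ℝ E]

/-- The union of `A × D` and `X × S`, where `D` and `S` are the unit ball and sphere of `F`. -/
def fiberDisc (A : Set X) (F : Submodule ℝ E) : Set (X × E) :=
  {q | q.2 ∈ F ∧ ‖q.2‖ ≤ 1 ∧ (‖q.2‖ ≠ 1 → q.1 ∈ A)}

namespace fiberDisc

variable {A : Set X} {F : Submodule ℝ E} {e : E}

lemma squeeze_mem (heF : e ∈ F) (he : ‖e‖ = 1) {q : X × E} (hq : q ∈ fiberDisc A F) {y l : ℝ}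
    (hl : 0 ≤ l) (h : 1 - y ^ 2 = l * (1 - inner ℝ e q.2 ^ 2)) :
    (q.1, squeeze e y l q.2) ∈ fiberDisc A F := by
  have hnorm := one_sub_norm_squeeze_sq he hl h
  refine ⟨F.add_mem (F.smul_mem _ heF) (F.smul_mem _ (F.sub_mem hq.1 (F.smul_mem _ heF))), ?_,
    fun h1 => hq.2.2 fun h2 => h1 ?_⟩
  · have := mul_nonneg hl (sub_nonneg.2 (pow_le_one₀ (norm_nonneg _) hq.2.1 (n := 2)))
    exact le_of_sq_le_sq (by linarith) zero_le_one
  · rw [h2, one_pow, sub_self, mul_zero] at hnorm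
    exact (pow_eq_one_iff_of_nonneg (norm_nonneg _) two_ne_zero).1 (by linarith)

variable (A F e) in
/-- The part of `fiberDisc A F` outside the constant section `-e`. -/
def cap : Set (fiberDisc A F) :=
  {q | -1 < inner ℝ e q.1.2}

lemma one_add_inner_pos (q : cap A F e) : 0 < 1 + inner ℝ e q.1.1.2 :=
  neg_lt_iff_pos_add'.1 q.2

lemma mem_cap_neg {q : fiberDisc A F} : q ∈ cap A F (-e) ↔ inner ℝ e q.1.2 < 1 := by
  simp [cap, inner_neg_left]

lemma cap_union_cap_neg : cap A F e ∪ cap A F (-e) = Set.univ := by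
  refine Set.eq_univ_of_forall fun q => (lt_or_ge (-1) (inner ℝ e q.1.2)).imp id fun h => ?_
  exact mem_cap_neg.2 (h.trans_lt (by norm_num))

variable (A F e) in
/-- The part of `fiberDisc A F` outside the constant sections `e` and `-e`. -/
abbrev band : Set (fiberDisc A F) :=
  cap A F e ∩ cap A F (-e)

lemma mem_band {q : fiberDisc A F} : q ∈ band A F e ↔ inner ℝ e q.1.2 ^ 2 < 1 := by
  rw [sq_lt_one_iff_abs_lt_one, abs_lt, Set.mem_inter_iff, mem_cap_neg]
  rfl

lemma one_sub_inner_sq_pos (q : band A F e) : 0 < 1 - inner ℝ e q.1.1.2 ^ 2 :=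
  sub_pos.2 (mem_band.1 q.2)

variable [TopologicalSpace X]

variable (A F) in
/-- The projection of `fiberDisc A F` to its base `X`. -/
def proj : C(fiberDisc A F, X) where
  toFun q := q.1.1

lemma isOpen_cap : IsOpen (cap A F e) :=
  isOpen_lt (by fun_prop) (by fun_prop)

variable (A) in
/-- The constant section `e` of `proj A F`. -/
def constSection (heF : e ∈ F) (he : ‖e‖ = 1) : C(X, fiberDisc A F) where
  toFun x := ⟨(x, e), heF, he.le, fun h => (h he).elim⟩

lemma exists_norm_eq_one_of_ne_bot (hF : F ≠ ⊥) : ∃ e ∈ F, ‖e‖ = 1 := by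
  obtain ⟨v, hv, hv0⟩ := F.ne_bot_iff.1 hF
  exact ⟨(‖v‖⁻¹ : ℝ) • v, F.smul_mem _ hv, norm_smul_inv_norm (𝕜 := ℝ) hv0⟩

/-- The map which squeezes each point `p t` along `e`. -/
noncomputable def squeezeMap {T : Type*} [TopologicalSpace T] (heF : e ∈ F) (he : ‖e‖ = 1)
    (p : C(T, fiberDisc A F)) (y l : C(T, ℝ)) (hl : ∀ t, 0 ≤ l t)
    (h : ∀ t, 1 - y t ^ 2 = l t * (1 - inner ℝ e (p t).1.2 ^ 2)) : C(T, fiberDisc A F) where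
  toFun t := ⟨((p t).1.1, squeeze e (y t) (l t) (p t).1.2),
    squeeze_mem heF he (p t).2 (hl t) (h t)⟩
  continuous_toFun := by
    unfold squeeze
    fun_prop

section Cap

/-- The height along `e` during the contraction of `cap A F e` to the section `e`. -/
noncomputable def capHeight : C(unitInterval × cap A F e, ℝ) where
  toFun t := inner ℝ e t.2.1.1.2 + t.1 * (1 - inner ℝ e t.2.1.1.2)

lemma one_add_capHeight_pos (t : unitInterval × cap A F e) : 0 < 1 + capHeight t := by
  have h := (convex_Ioi (-1 : ℝ)).add_smul_sub_mem t.2.2 (show -1 < (1 : ℝ) by norm_num) t.1.2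
  exact neg_lt_iff_pos_add'.1 h

/-- The scaling factor that goes with `capHeight`. -/
noncomputable def capFactor : C(unitInterval × cap A F e, ℝ) where
  toFun t := (1 - t.1) * (1 + capHeight t) / (1 + inner ℝ e t.2.1.1.2)
  continuous_toFun :=
    .div (by fun_prop) (by fun_prop) fun t => (one_add_inner_pos t.2).ne'

lemma capFactor_nonneg (t : unitInterval × cap A F e) : 0 ≤ capFactor t :=
  div_nonneg (mul_nonneg (sub_nonneg.2 t.1.2.2) (one_add_capHeight_pos t).le)
    (one_add_inner_pos t.2).le

lemma one_sub_capHeight_sq (t : unitInterval × cap A F e) :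
    1 - capHeight t ^ 2 = capFactor t * (1 - inner ℝ e t.2.1.1.2 ^ 2) := by
  have hx := (one_add_inner_pos t.2).ne'
  simp only [capFactor, capHeight, ContinuousMap.coe_mk]
  field_simp
  ring

/-- The complement of the section `-e` contracts to the section `e`. -/
noncomputable def capHomotopyEquiv (heF : e ∈ F) (he : ‖e‖ = 1) :
    ContinuousMap.HomotopyEquiv (cap A F e) X where
  toFun := (proj A F).restrict (cap A F e)
  invFun :=
    { toFun := fun x => ⟨constSection A heF he x, by simp [cap, constSection, he]⟩ }
  left_inv := by
    let H := squeezeMap heF he ⟨fun t : unitInterval × cap A F e => t.2.1, by fun_prop⟩ capHeight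
      capFactor capFactor_nonneg one_sub_capHeight_sq
    have hH (t : unitInterval × cap A F e) : H t ∈ cap A F e := by
      change -1 < inner ℝ e (squeeze e _ _ _)
      rw [inner_squeeze he]
      exact neg_lt_iff_pos_add'.2 (one_add_capHeight_pos t)
    refine .symm ⟨⟨⟨fun t => ⟨H t, hH t⟩, by fun_prop⟩, fun q => ?_, fun q => ?_⟩⟩
    · refine Subtype.ext (Subtype.ext (Prod.ext rfl ?_))
      change squeeze e (_ + 0 * _) ((1 - 0) * (1 + (_ + 0 * _)) / _) _ = _
      rw [zero_mul, add_zero, sub_zero, one_mul, div_self (one_add_inner_pos q).ne']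
      exact squeeze_inner_one
    · refine Subtype.ext (Subtype.ext (Prod.ext rfl ?_))
      change squeeze e (_ + 1 * _) ((1 - 1) * _ / _) _ = _
      rw [one_mul, add_sub_cancel, sub_self, zero_mul, zero_div, squeeze_one_zero]
      rfl
  right_inv := .refl _

end Cap

section Band

/-- The height along `e` during the contraction of `band A F e` to the part orthogonal to `e`. -/
noncomputable def bandHeight : C(unitInterval × band A F e, ℝ) where
  toFun t := t.1 * inner ℝ e t.2.1.1.2

lemma bandHeight_sq_lt_one (t : unitInterval × band A F e) : bandHeight t ^ 2 < 1 := by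
  change (t.1 * inner ℝ e t.2.1.1.2) ^ 2 < 1
  rw [mul_pow]
  exact mul_lt_one_of_nonneg_of_lt_one_right (pow_le_one₀ t.1.2.1 t.1.2.2) (sq_nonneg _)
    (mem_band.1 t.2.2)

/-- The scaling factor that goes with `bandHeight`. -/
noncomputable def bandFactor : C(unitInterval × band A F e, ℝ) where
  toFun t := (1 - bandHeight t ^ 2) / (1 - inner ℝ e t.2.1.1.2 ^ 2)
  continuous_toFun :=
    .div (by fun_prop) (by fun_prop) fun t => (one_sub_inner_sq_pos t.2).ne'

lemma bandFactor_nonneg (t : unitInterval × band A F e) : 0 ≤ bandFactor t :=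
  div_nonneg (sub_pos.2 (bandHeight_sq_lt_one t)).le (one_sub_inner_sq_pos t.2).le

lemma one_sub_bandHeight_sq (t : unitInterval × band A F e) :
    1 - bandHeight t ^ 2 = bandFactor t * (1 - inner ℝ e t.2.1.1.2 ^ 2) :=
  (div_mul_cancel₀ _ (one_sub_inner_sq_pos t.2).ne').symm

/-- The squeezing of `band A F e` to the part orthogonal to `e`. -/
noncomputable def bandSqueeze (heF : e ∈ F) (he : ‖e‖ = 1) :
    C(unitInterval × band A F e, band A F e) where
  toFun t := ⟨squeezeMap heF he ⟨fun t => t.2.1, by fun_prop⟩ bandHeight bandFactor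
    bandFactor_nonneg one_sub_bandHeight_sq t, by
      rw [mem_band]
      change inner ℝ e (squeeze e _ _ _) ^ 2 < 1
      rw [inner_squeeze he]
      exact bandHeight_sq_lt_one t⟩

/-- The complement of the sections `e` and `-e` contracts to the part orthogonal to `e`. -/
noncomputable def bandHomotopyEquiv (heF : e ∈ F) (he : ‖e‖ = 1) :
    ContinuousMap.HomotopyEquiv (band A F e) (fiberDisc A (F ⊓ (ℝ ∙ e)ᗮ)) where
  toFun :=
    { toFun := fun q => ⟨(bandSqueeze heF he (0, q)).1.1,
        ⟨(bandSqueeze heF he (0, q)).1.2.1,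
          Submodule.mem_orthogonal_singleton_iff_inner_right.2
            ((inner_squeeze he).trans (zero_mul _))⟩, (bandSqueeze heF he (0, q)).1.2.2⟩
      continuous_toFun := .subtype_mk (continuous_subtype_val.comp (continuous_subtype_val.comp
        ((bandSqueeze heF he).continuous.comp (by fun_prop)))) _ }
  invFun :=
    { toFun := fun q => ⟨⟨q.1, q.2.1.1, q.2.2⟩, by
        rw [mem_band, (Submodule.mem_orthogonal_singleton_iff_inner_right).1 q.2.1.2]
        norm_num⟩ }
  left_inv := by
    refine ⟨⟨bandSqueeze heF he, fun q => rfl, fun q => ?_⟩⟩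
    refine Subtype.ext (Subtype.ext (Prod.ext rfl ?_))
    change squeeze e (1 * _) ((1 - (1 * _) ^ 2) / _) _ = _
    rw [one_mul, div_self (one_sub_inner_sq_pos q).ne']
    exact squeeze_inner_one
  right_inv := by
    refine ⟨.cast (.refl (.id _)) (ContinuousMap.ext fun q => ?_).symm rfl⟩
    refine Subtype.ext (Prod.ext rfl ?_)
    have hq : inner ℝ e q.1.2 = 0 :=
      (Submodule.mem_orthogonal_singleton_iff_inner_right).1 q.2.1.2
    change squeeze e (0 * inner ℝ e q.1.2)
      ((1 - (0 * inner ℝ e q.1.2) ^ 2) / (1 - inner ℝ e q.1.2 ^ 2)) q.1.2 = q.1.2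
    rw [zero_mul, hq, div_self (by norm_num)]
    exact (congrArg (squeeze e · 1 q.1.2) hq.symm).trans squeeze_inner_one

end Band

variable (A) in
/-- The fibrewise disc of dimension `0`. -/
def botHomeomorph : fiberDisc A (⊥ : Submodule ℝ E) ≃ₜ A where
  toFun q := ⟨q.1.1, q.2.2.2 (by simp [(Submodule.mem_bot ℝ).1 q.2.1])⟩
  invFun x := ⟨(x, 0), by simp [fiberDisc]⟩
  left_inv q := Subtype.ext (Prod.ext rfl ((Submodule.mem_bot ℝ).1 q.2.1).symm)
  right_inv _ := rfl

section Homology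

variable {k : Type u} [Field k]

lemma singularHomologyMap_proj_surjective (hF : F ≠ ⊥) :
    Function.Surjective (singularHomologyMap k (proj A F)) := by
  obtain ⟨e, heF, he⟩ := exists_norm_eq_one_of_ne_bot hF
  refine Function.RightInverse.surjective (g := singularHomologyMap k (constSection A heF he)) ?_
  have hsection : (proj A F).comp (constSection A heF he) = .id X := rfl
  refine LinearMap.congr_fun (f := singularHomologyMap k (proj A F) ∘ₗ _) (g := .id) ?_
  rw [← singularHomologyMap_comp, hsection, singularHomologyMap_id]

lemma finrank_range_proj_bot :
    Module.finrank k (LinearMap.range (singularHomologyMap k (proj A (⊥ : Submodule ℝ E)))) =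
      Module.finrank k
        (LinearMap.range (singularHomologyMap k ((ContinuousMap.id X).restrict A))) := by
  rw [← range_singularHomologyMap_comp ((ContinuousMap.id X).restrict A)
    (botHomeomorph (E := E) A).toHomotopyEquiv]
  rfl

lemma finite_and_finrank_add_of_inf_orthogonal [Module.Finite k (SingularHomology k X)]
    (heF : e ∈ F) (he : ‖e‖ = 1)
    [Module.Finite k (SingularHomology k (fiberDisc A (F ⊓ (ℝ ∙ e)ᗮ)))] :
    Module.Finite k (SingularHomology k (fiberDisc A F)) ∧
      Module.finrank k (SingularHomology k (fiberDisc A F)) + 2 * Module.finrank k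
          (LinearMap.range (singularHomologyMap k (proj A (F ⊓ (ℝ ∙ e)ᗮ)))) =
        Module.finrank k (SingularHomology k (fiberDisc A (F ⊓ (ℝ ∙ e)ᗮ))) +
          2 * Module.finrank k (SingularHomology k X) := by
  let φ := singularHomologyEquiv k (bandHomotopyEquiv (A := A) heF he)
  have : Module.Finite k (SingularHomology k (band A F e)) := .equiv φ.symm
  have hrange : LinearMap.range (singularHomologyMap k ((proj A F).restrict (band A F e))) =
      LinearMap.range (singularHomologyMap k (proj A (F ⊓ (ℝ ∙ e)ᗮ))) :=
    range_singularHomologyMap_comp (proj A _) (bandHomotopyEquiv heF he)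
  have hmv := finite_and_finrank_of_mayerVietoris (k := k) isOpen_cap isOpen_cap cap_union_cap_neg
    (singularHomologyEquiv k (capHomotopyEquiv (A := A) heF he)).bijective
    (singularHomologyEquiv k (capHomotopyEquiv (A := A) (F.neg_mem heF)
      ((norm_neg e).trans he))).bijective
  rwa [hrange, φ.finrank_eq] at hmv

/-- Induction on `dim F`. Once the disc one dimension lower is nondegenerate its projection is
surjective in homology, so the rank no longer changes: only the first step sees the map `A → X`. -/
theorem finite_and_finrank [FiniteDimensional ℝ F] (hF : F ≠ ⊥)
    [Module.Finite k (SingularHomology k X)] [Module.Finite k (SingularHomology k A)] :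
    Module.Finite k (SingularHomology k (fiberDisc A F)) ∧
      Module.finrank k (SingularHomology k (fiberDisc A F)) + 2 * Module.finrank k
          (LinearMap.range (singularHomologyMap k ((ContinuousMap.id X).restrict A))) =
        Module.finrank k (SingularHomology k A) + 2 * Module.finrank k (SingularHomology k X) := by
  induction hn : Module.finrank ℝ F using Nat.strong_induction_on generalizing F with
  | _ n ih =>
    obtain ⟨e, heF, he⟩ := exists_norm_eq_one_of_ne_bot hF
    obtain hG | hG := eq_or_ne (F ⊓ (ℝ ∙ e)ᗮ) ⊥
    · let φ := singularHomologyEquiv k (botHomeomorph (E := E) A).toHomotopyEquiv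
      have : Module.Finite k (SingularHomology k (fiberDisc A (F ⊓ (ℝ ∙ e)ᗮ))) :=
        hG ▸ .equiv φ.symm
      have hstep := finite_and_finrank_add_of_inf_orthogonal (k := k) (A := A) heF he
      rwa [hG, finrank_range_proj_bot, φ.finrank_eq] at hstep
    · have hlt : Module.finrank ℝ ↥(F ⊓ (ℝ ∙ e)ᗮ) < n := by
        refine hn ▸ Submodule.finrank_lt_finrank_of_lt (inf_le_left.lt_of_ne fun h => ?_)
        have hee := Submodule.mem_orthogonal_singleton_iff_inner_right.1 (h.ge heF).2
        simp [inner_self_eq_zero.1 hee] at he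
      obtain ⟨hfinite, hfinrank⟩ := ih _ hlt hG rfl
      have hstep := finite_and_finrank_add_of_inf_orthogonal (k := k) (A := A) heF he
      rw [LinearMap.range_eq_top.2 (singularHomologyMap_proj_surjective hG), finrank_top] at hstep
      exact ⟨hstep.1, by lia⟩

lemma finrank_le [FiniteDimensional ℝ F] (hF : F ≠ ⊥) [Module.Finite k (SingularHomology k X)]
    [Module.Finite k (SingularHomology k A)] :
    Module.finrank k (SingularHomology k A) ≤
      Module.finrank k (SingularHomology k (fiberDisc A F)) := by
  have hfinrank := (finite_and_finrank (k := k) (A := A) hF).2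
  have hrange := (LinearMap.range
    (singularHomologyMap k ((ContinuousMap.id X).restrict A))).finrank_le
  lia

lemma finrank_of_isEmpty [FiniteDimensional ℝ F] (hF : F ≠ ⊥)
    [Module.Finite k (SingularHomology k X)] [IsEmpty A] :
    Module.finrank k (SingularHomology k (fiberDisc A F)) =
      2 * Module.finrank k (SingularHomology k X) := by
  have hA : Module.finrank k (SingularHomology k A) = 0 :=
    (singularHomologyEquivFinsupp k A).finrank_eq.trans Module.finrank_zero_of_subsingleton
  have : Module.Finite k (SingularHomology k A) := .equiv (singularHomologyEquivFinsupp k A).symm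
  have hfinrank := (finite_and_finrank (k := k) (A := A) hF).2
  have hrange := (singularHomologyMap k ((ContinuousMap.id X).restrict A)).finrank_range_le
  lia

end Homology

end fiberDisc

end FiberDisc

section DiscProduct

variable {E : Type} [NormedAddCommGroup E] [InnerProductSpace ℝ E] {m : ℕ}

/-- The polyhedral product over `𝒦` of the unit balls and spheres of the subspaces `F i`. -/
def discProduct (𝒦 : Set (Set (Fin m))) (F : Fin m → Submodule ℝ E) : Set (Fin m → E) :=
  {z | (∀ i, z i ∈ F i ∧ ‖z i‖ ≤ 1) ∧ {i | ‖z i‖ ≠ 1} ∈ 𝒦}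

/-- The simplices of `𝒦` not containing the vertex `i`. -/
def deletion (𝒦 : Set (Set (Fin (m + 1)))) (i : Fin (m + 1)) : Set (Set (Fin m)) :=
  {τ | i.succAbove '' τ ∈ 𝒦}

/-- The link of the vertex `i` in `𝒦`. -/
def link (𝒦 : Set (Set (Fin (m + 1)))) (i : Fin (m + 1)) : Set (Set (Fin m)) :=
  {τ | insert i (i.succAbove '' τ) ∈ 𝒦}

section Coordinate

variable {𝒦 : Set (Set (Fin (m + 1)))} {i : Fin (m + 1)}

lemma isLowerSet_deletion (h : IsLowerSet 𝒦) : IsLowerSet (deletion 𝒦 i) :=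
  fun _ _ hle ha => h (Set.image_mono hle) ha

lemma isLowerSet_link (h : IsLowerSet 𝒦) : IsLowerSet (link 𝒦 i) :=
  fun _ _ hle ha => h (Set.insert_subset_insert (Set.image_mono hle)) ha

lemma link_subset_deletion (h : IsLowerSet 𝒦) : link 𝒦 i ⊆ deletion 𝒦 i :=
  fun _ ha => h (Set.subset_insert _ _) ha

/-- The points of the disc product of the deletion which lie over the link. -/
def linkProduct (𝒦 : Set (Set (Fin (m + 1)))) (i : Fin (m + 1)) (F : Fin m → Submodule ℝ E) :
    Set (discProduct (deletion 𝒦 i) F) :=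
  {y | {j | ‖y.1 j‖ ≠ 1} ∈ link 𝒦 i}

/-- Inside the disc product of the deletion, `linkProduct` is the disc product of the link. -/
def linkProductHomeomorph (h : IsLowerSet 𝒦) (i : Fin (m + 1)) (F : Fin m → Submodule ℝ E) :
    linkProduct 𝒦 i F ≃ₜ discProduct (link 𝒦 i) F where
  toFun y := ⟨y.1.1, y.1.2.1, y.2⟩
  invFun y := ⟨⟨y.1, y.2.1, link_subset_deletion h y.2.2⟩, y.2.2⟩

lemma insertNth_mem_discProduct (h : IsLowerSet 𝒦) {F : Fin (m + 1) → Submodule ℝ E}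
    {y : discProduct (deletion 𝒦 i) (i.removeNth F)} {z : E}
    (hz : (y, z) ∈ fiberDisc (linkProduct 𝒦 i (i.removeNth F)) (F i)) :
    i.insertNth z y.1 ∈ discProduct 𝒦 F := by
  refine ⟨i.forall_iff_succAbove.2 ⟨?_, fun j => ?_⟩, ?_⟩
  · simpa using ⟨hz.1, hz.2.1⟩
  · simpa [Fin.removeNth] using y.2.1 j
  · by_cases hz1 : ‖z‖ = 1
    · refine h (fun j hj => ?_) y.2.2
      obtain rfl | ⟨j, rfl⟩ := Fin.eq_self_or_eq_succAbove i j
      · simp [hz1] at hj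
      · exact ⟨j, by simpa using hj, rfl⟩
    · refine h (fun j hj => ?_) (hz.2.2 hz1)
      obtain rfl | ⟨j, rfl⟩ := Fin.eq_self_or_eq_succAbove i j
      · exact Set.mem_insert _ _
      · exact Set.mem_insert_of_mem _ ⟨j, by simpa using hj, rfl⟩

/-- A disc product is a fibrewise disc with respect to each of its coordinates. -/
def discProductHomeomorph (h : IsLowerSet 𝒦) (i : Fin (m + 1)) (F : Fin (m + 1) → Submodule ℝ E) :
    discProduct 𝒦 F ≃ₜ fiberDisc (linkProduct 𝒦 i (i.removeNth F)) (F i) where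
  toFun z := ⟨(⟨i.removeNth z.1, fun j => z.2.1 _,
      h (Set.image_subset_iff.2 subset_rfl) z.2.2⟩, z.1 i),
    (z.2.1 i).1, (z.2.1 i).2,
    fun hi => h (Set.insert_subset hi (Set.image_subset_iff.2 subset_rfl)) z.2.2⟩
  invFun q := ⟨i.insertNth q.1.2 q.1.1.1, insertNth_mem_discProduct h q.2⟩
  left_inv z := Subtype.ext (i.insertNth_self_removeNth z.1)
  right_inv q := Subtype.ext (Prod.ext (Subtype.ext (by simp)) (by simp))
  continuous_toFun := .subtype_mk (.prodMk (.subtype_mk (continuous_pi fun _ =>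
    (continuous_apply _).comp continuous_subtype_val) _)
    ((continuous_apply i).comp continuous_subtype_val)) _
  continuous_invFun := .subtype_mk (.finInsertNth i (by fun_prop) (by fun_prop)) _

end Coordinate

variable (k : Type u) [Field k] [FiniteDimensional ℝ E] {𝒦 : Set (Set (Fin m))}

lemma finite_discProduct (h : IsLowerSet 𝒦) (F : Fin m → Submodule ℝ E) (hF : ∀ i, F i ≠ ⊥) :
    Module.Finite k (SingularHomology k (discProduct 𝒦 F)) := by
  induction m with
  | zero => exact .equiv (singularHomologyEquivFinsupp k (discProduct 𝒦 F)).symm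
  | succ m ih =>
    have := ih (isLowerSet_deletion (i := 0) h) (Fin.removeNth 0 F) fun _ => hF _
    have hlink := ih (isLowerSet_link (i := 0) h) (Fin.removeNth 0 F) fun _ => hF _
    have : Module.Finite k (SingularHomology k (linkProduct 𝒦 0 (Fin.removeNth 0 F))) :=
      .equiv (singularHomologyEquiv k (linkProductHomeomorph h 0 _).toHomotopyEquiv).symm
    have := (fiberDisc.finite_and_finrank (k := k) (A := linkProduct 𝒦 0 (Fin.removeNth 0 F))
      (hF 0)).1
    exact .equiv (singularHomologyEquiv k (discProductHomeomorph h 0 F).toHomotopyEquiv).symm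

lemma finite_linkProduct {𝒦 : Set (Set (Fin (m + 1)))} (h : IsLowerSet 𝒦) (i : Fin (m + 1))
    {F : Fin m → Submodule ℝ E} (hF : ∀ j, F j ≠ ⊥) :
    Module.Finite k (SingularHomology k (linkProduct 𝒦 i F)) :=
  have := finite_discProduct k (isLowerSet_link (i := i) h) F hF
  .equiv (singularHomologyEquiv k (linkProductHomeomorph h i F).toHomotopyEquiv).symm

lemma finrank_discProduct_update (h : IsLowerSet 𝒦) {F : Fin m → Submodule ℝ E}
    (hF : ∀ i, F i ≠ ⊥) (i : Fin m) {L : Submodule ℝ E} (hL : L ≠ ⊥) :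
    Module.finrank k (SingularHomology k (discProduct 𝒦 (Function.update F i L))) =
      Module.finrank k (SingularHomology k (discProduct 𝒦 F)) := by
  obtain _ | m := m
  · exact i.elim0
  have := finite_discProduct k (isLowerSet_deletion (i := i) h) (i.removeNth F) fun _ => hF _
  have := finite_linkProduct k h i (F := i.removeNth F) fun _ => hF _
  have hfinrank {N : Submodule ℝ E} (hN : N ≠ ⊥) := (fiberDisc.finite_and_finrank (k := k)
    (A := linkProduct 𝒦 i (i.removeNth F)) hN).2
  have e := (singularHomologyEquiv k (discProductHomeomorph h i F).toHomotopyEquiv).finrank_eq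
  have e' := (singularHomologyEquiv k
    (discProductHomeomorph h i (Function.update F i L)).toHomotopyEquiv).finrank_eq
  rw [Fin.removeNth_update, Function.update_self] at e'
  have := hfinrank hL
  have := hfinrank (hF i)
  lia

lemma finrank_discProduct_eq (h : IsLowerSet 𝒦) {F F' : Fin m → Submodule ℝ E}
    (hF : ∀ i, F i ≠ ⊥) (hF' : ∀ i, F' i ≠ ⊥) :
    Module.finrank k (SingularHomology k (discProduct 𝒦 F)) =
      Module.finrank k (SingularHomology k (discProduct 𝒦 F')) := by
  suffices hs : ∀ s : Finset (Fin m),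
      Module.finrank k (SingularHomology k (discProduct 𝒦 (s.piecewise F F'))) =
        Module.finrank k (SingularHomology k (discProduct 𝒦 F')) by
    rw [← hs Finset.univ, Finset.piecewise_univ]
  intro s
  induction s using Finset.induction_on with
  | empty => rw [Finset.piecewise_empty]
  | insert i s _ ih =>
    rw [Finset.piecewise_insert, finrank_discProduct_update k h (fun j => ?_) i (hF i), ih]
    exact s.piecewise_cases F F' (· ≠ ⊥) (hF j) (hF' j)

lemma exists_two_pow_le_finrank_discProduct (h : IsLowerSet 𝒦) (h0 : ∅ ∈ 𝒦)
    {F : Fin m → Submodule ℝ E} (hF : ∀ i, F i ≠ ⊥) :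
    ∃ σ ∈ 𝒦, 2 ^ m ≤ Module.finrank k (SingularHomology k (discProduct 𝒦 F)) * 2 ^ σ.ncard := by
  induction m with
  | zero =>
    have : Unique (discProduct 𝒦 F) :=
      { default := ⟨Fin.elim0, Fin.rec0, by simpa [Set.eq_empty_of_isEmpty] using h0⟩
        uniq _ := Subtype.ext (Subsingleton.elim _ _) }
    exact ⟨∅, h0, by simp [(singularHomologyEquivFinsupp k (discProduct 𝒦 F)).finrank_eq]⟩
  | succ m ih =>
    set F' := Fin.removeNth 0 F
    have hF' : ∀ i, F' i ≠ ⊥ := fun _ => hF _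
    have := finite_discProduct k (isLowerSet_deletion (i := 0) h) F' hF'
    have := finite_linkProduct k h 0 hF'
    rw [(singularHomologyEquiv k (discProductHomeomorph h 0 F).toHomotopyEquiv).finrank_eq]
    by_cases hv : {0} ∈ 𝒦
    · obtain ⟨τ, hτ, hle⟩ := ih (isLowerSet_link (i := 0) h) (by simpa [link] using hv) hF'
      refine ⟨_, hτ, ?_⟩
      rw [Set.ncard_insert_of_notMem (by simp) (Set.toFinite _),
        Set.ncard_image_of_injective _ Fin.succAbove_right_injective, pow_succ, pow_succ,
        ← mul_assoc]
      refine Nat.mul_le_mul_right 2 (hle.trans (Nat.mul_le_mul_right _ ?_))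
      rw [← (singularHomologyEquiv k (linkProductHomeomorph h 0 F').toHomotopyEquiv).finrank_eq]
      exact fiberDisc.finrank_le (hF 0)
    · obtain ⟨τ, hτ, hle⟩ :=
        ih (isLowerSet_deletion (i := 0) h) (by simpa [deletion] using h0) hF'
      have : IsEmpty (linkProduct 𝒦 0 F') :=
        ⟨fun y => hv (h (by simp) y.2)⟩
      refine ⟨_, hτ, ?_⟩
      rw [fiberDisc.finrank_of_isEmpty (hF 0),
        Set.ncard_image_of_injective _ Fin.succAbove_right_injective, pow_succ]
      linarith

lemma le_finrank_discProduct (h : IsLowerSet 𝒦) (h0 : ∅ ∈ 𝒦) {F : Fin m → Submodule ℝ E}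
    (hF : ∀ i, F i ≠ ⊥) {n : ℕ} (hn : ∀ σ ∈ 𝒦, n * 2 ^ σ.ncard ≤ 2 ^ m) :
    n ≤ Module.finrank k (SingularHomology k (discProduct 𝒦 F)) := by
  obtain ⟨σ, hσ, hle⟩ := exists_two_pow_le_finrank_discProduct k h h0 hF
  exact Nat.le_of_mul_le_mul_right ((hn σ hσ).trans hle) (by positivity)

end DiscProduct

section MomentAngle

variable {m : ℕ}

/-- The subsets of simplices of `K`, as a lower set of subsets of the vertex set. The empty simplex
has to be added since the faces of an `AbstractSimplicialComplex` are nonempty. -/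
def simplexSets (K : AbstractSimplicialComplex (Fin m)) : Set (Set (Fin m)) :=
  {s | ∃ σ : Finset (Fin m), (σ = ∅ ∨ σ ∈ K.faces) ∧ s ⊆ σ}

variable (K : AbstractSimplicialComplex (Fin m))

lemma isLowerSet_simplexSets : IsLowerSet (simplexSets K) :=
  fun _ _ hts ⟨σ, hσ, h⟩ => ⟨σ, hσ, hts.trans h⟩

lemma empty_mem_simplexSets : ∅ ∈ simplexSets K := ⟨∅, .inl rfl, Set.empty_subset _⟩

lemma mem_polyhedralProduct_closedBall_sphere {E : Type*} [SeminormedAddCommGroup E]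
    {z : Fin m → E} :
    z ∈ polyhedralProduct K (Metric.closedBall 0 1) (Metric.sphere 0 1) ↔
      (∀ i, ‖z i‖ ≤ 1) ∧ {i | ‖z i‖ ≠ 1} ∈ simplexSets K := by
  simp only [polyhedralProduct, Set.mem_ofPred_eq, mem_closedBall_zero_iff,
    mem_sphere_zero_iff_norm]
  constructor
  · rintro ⟨σ, hσ, h⟩
    refine ⟨fun i => ?_, σ, hσ, fun i hi => by_contra fun hiσ => hi ((h i).2 hiσ)⟩
    by_cases hi : i ∈ σ
    exacts [(h i).1 hi, ((h i).2 hi).le]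
  · rintro ⟨hle, σ, hσ, h⟩
    exact ⟨σ, hσ, fun i => ⟨fun _ => hle i, fun hi => by_contra fun hne => hi (h hne)⟩⟩

lemma exists_mem_polyhedralProduct_forall_eq_zero (E : Type*) [NormedRing E] [NormOneClass E]
    {σ : Set (Fin m)} (hσ : σ ∈ simplexSets K) :
    ∃ z ∈ polyhedralProduct K (Metric.closedBall (0 : E) 1) (Metric.sphere 0 1),
      ∀ i ∈ σ, z i = 0 := by
  classical
  refine ⟨fun i => if i ∈ σ then 0 else 1,
    (mem_polyhedralProduct_closedBall_sphere K).2 ⟨fun i => ?_, ?_⟩, fun i hi => if_pos hi⟩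
  · split_ifs <;> simp
  · exact isLowerSet_simplexSets K (fun i hi => by_contra fun hiσ => hi (by simp [hiσ])) hσ

lemma momentAngleComplex_eq_discProduct :
    momentAngleComplex K = discProduct (simplexSets K) fun _ => ⊤ := by
  ext z
  simp [momentAngleComplex, mem_polyhedralProduct_closedBall_sphere, discProduct]

variable {K} in
lemma ofReal_mem_discProduct {x : Fin m → ℝ} (hx : x ∈ realMomentAngleComplex K) :
    (fun i => (x i : ℂ)) ∈ discProduct (simplexSets K) fun _ => LinearMap.ker Complex.imLm := by
  simpa [discProduct] using (mem_polyhedralProduct_closedBall_sphere K).1 hx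

variable {K} in
lemma re_mem_realMomentAngleComplex {z : Fin m → ℂ}
    (hz : z ∈ discProduct (simplexSets K) fun _ => LinearMap.ker Complex.imLm) :
    (fun i => (z i).re) ∈ realMomentAngleComplex K := by
  have hnorm (i) : ‖(z i).re‖ = ‖z i‖ := Complex.abs_re_eq_norm.2 (hz.1 i).1
  refine (mem_polyhedralProduct_closedBall_sphere K).2 ?_
  simpa only [hnorm] using ⟨fun i => (hz.1 i).2, hz.2⟩

/-- The real moment-angle complex as the disc product of the real lines in `ℂ`. -/
noncomputable def realMomentAngleComplexHomeomorph :
    realMomentAngleComplex K ≃ₜ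
      discProduct (simplexSets K) fun _ => LinearMap.ker Complex.imLm where
  toFun x := ⟨_, ofReal_mem_discProduct x.2⟩
  invFun z := ⟨_, re_mem_realMomentAngleComplex z.2⟩
  left_inv _ := rfl
  right_inv z := Subtype.ext (funext fun i => Complex.ext rfl (z.2.1 i).1.symm)
  continuous_toFun := .subtype_mk (continuous_pi fun i =>
    Complex.continuous_ofReal.comp ((continuous_apply i).comp continuous_subtype_val)) _
  continuous_invFun := .subtype_mk (continuous_pi fun i =>
    Complex.continuous_re.comp ((continuous_apply i).comp continuous_subtype_val)) _

lemma ker_imLm_ne_bot : LinearMap.ker Complex.imLm ≠ ⊥ :=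
  (Submodule.ne_bot_iff _).2 ⟨1, by simp, one_ne_zero⟩

variable (k : Type u) [Field k]

lemma totalBetti_eq_finrank (X : Type) [TopologicalSpace X]
    [Module.Finite k (SingularHomology k X)] :
    totalBetti k X = Module.finrank k (SingularHomology k X) :=
  sum_rank_linearYonedaObj (singularComplex k X)

lemma finite_momentAngleComplex :
    Module.Finite k (SingularHomology k (momentAngleComplex K)) := by
  rw [momentAngleComplex_eq_discProduct]
  exact finite_discProduct k (isLowerSet_simplexSets K) _ fun _ => top_ne_bot

lemma finite_realMomentAngleComplex :
    Module.Finite k (SingularHomology k (realMomentAngleComplex K)) :=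
  have := finite_discProduct k (isLowerSet_simplexSets K) _ fun _ => ker_imLm_ne_bot
  .equiv (singularHomologyEquiv k (realMomentAngleComplexHomeomorph K).toHomotopyEquiv).symm

lemma finrank_realMomentAngleComplex :
    Module.finrank k (SingularHomology k (realMomentAngleComplex K)) =
      Module.finrank k (SingularHomology k (momentAngleComplex K)) := by
  rw [momentAngleComplex_eq_discProduct, finrank_discProduct_eq k (isLowerSet_simplexSets K)
    (fun _ => top_ne_bot) fun _ => ker_imLm_ne_bot]
  exact (singularHomologyEquiv k (realMomentAngleComplexHomeomorph K).toHomotopyEquiv).finrank_eq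

lemma le_finrank_momentAngleComplex {n : ℕ} (hn : ∀ σ ∈ simplexSets K, n * 2 ^ σ.ncard ≤ 2 ^ m) :
    n ≤ Module.finrank k (SingularHomology k (momentAngleComplex K)) := by
  rw [momentAngleComplex_eq_discProduct]
  exact le_finrank_discProduct k (isLowerSet_simplexSets K) (empty_mem_simplexSets K)
    (fun _ => top_ne_bot) hn

end MomentAngle

section FreeAction

variable {m : ℕ}

/-- An element of `A` is determined by the set of coordinates off `σ` at which it equals `1`. -/
lemma natCard_mul_two_pow_ncard_le {G : Type*} [Group G] {c : G}
    (hc : ∀ z : G, z * z = 1 → z = 1 ∨ z = c) {A : Subgroup (Fin m → G)}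
    (hA : ∀ a ∈ A, a * a = 1) {σ : Set (Fin m)}
    (hσ : ∀ a ∈ A, (∀ i ∉ σ, a i = 1) → a = 1) :
    Nat.card A * 2 ^ σ.ncard ≤ 2 ^ m := by
  let f (a : A) : Set ↥σᶜ := {i | a.1 i = 1}
  have hf : f.Injective := fun a b hab => by
    refine div_eq_one.1 (Subtype.ext (hσ _ (a / b).2 fun i hi => div_eq_one.2 ?_))
    have hi1 : a.1 i = 1 ↔ b.1 i = 1 := Set.ext_iff.1 hab ⟨i, hi⟩
    rcases hc _ (congrFun (hA a a.2) i) with ha | ha <;>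
      rcases hc _ (congrFun (hA b b.2) i) with hb | hb <;> grind
  calc Nat.card A * 2 ^ σ.ncard ≤ 2 ^ σᶜ.ncard * 2 ^ σ.ncard := by
        refine Nat.mul_le_mul_right _ ((Nat.card_le_card_of_injective f hf).trans_eq ?_)
        classical
        rw [Nat.card_eq_fintype_card, Fintype.card_set, ← Nat.card_eq_fintype_card,
          Nat.card_coe_set_eq]
    _ = 2 ^ m := by rw [← pow_add, add_comm, Set.ncard_add_ncard_compl, Nat.card_fin]

lemma eq_one_of_isCancelSMul {E G : Type*} [MulZeroOneClass E] [Group G] (χ : G →* E)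
    {Z : Set (Fin m → E)} [MulAction (Fin m → G) Z]
    (hχ : ∀ (g : Fin m → G) (z : Z) i, (g • z).1 i = χ (g i) * z.1 i)
    {A : Subgroup (Fin m → G)} [IsCancelSMul A Z] {σ : Set (Fin m)} {z : Fin m → E} (hz : z ∈ Z)
    (hzσ : ∀ i ∈ σ, z i = 0) {a : Fin m → G} (ha : a ∈ A) (haσ : ∀ i ∉ σ, a i = 1) : a = 1 := by
  have hfix : (⟨a, ha⟩ : A) • (⟨z, hz⟩ : Z) = ⟨z, hz⟩ := by
    refine Subtype.ext (funext fun i => (hχ a _ i).trans ?_)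
    by_cases hi : i ∈ σ
    · simp [hzσ i hi]
    · simp [haσ i hi]
  exact congrArg Subtype.val (IsCancelSMul.eq_one_of_smul hfix)

lemma circle_eq_one_or_eq_exp_pi {z : Circle} (h : z * z = 1) : z = 1 ∨ z = Circle.exp Real.pi := by
  have h' : (z : ℂ) * z = 1 := congrArg Subtype.val h
  refine (mul_self_eq_one_iff.1 h').imp Circle.ext fun hz => Circle.ext (hz.trans ?_)
  simp [Circle.coe_exp]

variable {K : AbstractSimplicialComplex (Fin m)} {σ : Set (Fin m)}

lemma natCard_mul_two_pow_ncard_le_of_momentAngleComplex (hσ : σ ∈ simplexSets K)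
    {A : Subgroup (Fin m → Circle)} (hA : ∀ a ∈ A, a * a = 1)
    [IsCancelSMul A (momentAngleComplex K)] : Nat.card A * 2 ^ σ.ncard ≤ 2 ^ m := by
  obtain ⟨z, hz, hzσ⟩ := exists_mem_polyhedralProduct_forall_eq_zero K ℂ hσ
  exact natCard_mul_two_pow_ncard_le (fun _ => circle_eq_one_or_eq_exp_pi) hA fun _ =>
    eq_one_of_isCancelSMul Circle.coeHom (Z := momentAngleComplex K) (fun _ _ _ => rfl) hz hzσ

lemma natCard_mul_two_pow_ncard_le_of_realMomentAngleComplex (hσ : σ ∈ simplexSets K)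
    {A : Subgroup (Fin m → ℤˣ)} [IsCancelSMul A (realMomentAngleComplex K)] :
    Nat.card A * 2 ^ σ.ncard ≤ 2 ^ m := by
  obtain ⟨x, hx, hxσ⟩ := exists_mem_polyhedralProduct_forall_eq_zero K ℝ hσ
  exact natCard_mul_two_pow_ncard_le (fun u _ => Int.units_eq_one_or u)
    (fun _ _ => funext fun _ => Int.units_mul_self _) fun _ => eq_one_of_isCancelSMul
      ((Int.castRingHom ℝ : ℤ →* ℝ).comp (Units.coeHom ℤ)) (Z := realMomentAngleComplex K)
      (fun _ _ _ => rfl) hx hxσ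

/-- The `2`-torsion of a subtorus of rank `r` is an elementary abelian `2`-group of rank `r`. -/
lemma IsSubtorusOfRank.exists_le {H : Subgroup (Fin m → Circle)} {r : ℕ}
    (hH : IsSubtorusOfRank H r) : ∃ A ≤ H, (∀ a ∈ A, a * a = 1) ∧ Nat.card A = 2 ^ r := by
  obtain ⟨e⟩ := hH
  let f : (Fin r → Multiplicative (ZMod 2)) →* (Fin m → Circle) :=
    H.subtype.comp ((e.symm : (Fin r → Circle) →* H).comp
      ((ZMod.toCircle (N := 2)).toMonoidHom.compLeft (Fin r)))
  have hf : Function.Injective f := H.subtype_injective.comp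
    (e.symm.injective.comp (ZMod.injective_toCircle (N := 2)).comp_left)
  have hsq (x : Fin r → Multiplicative (ZMod 2)) : x * x = 1 :=
    funext fun i => CharTwo.add_self_eq_zero (x i).toAdd
  refine ⟨f.range, ?_, ?_, ?_⟩
  · rintro _ ⟨x, rfl⟩
    exact Subtype.prop _
  · rintro _ ⟨x, rfl⟩
    rw [← map_mul, hsq, map_one]
  · rw [← Nat.card_congr (MonoidHom.ofInjective hf).toEquiv]
    simp

lemma IsTwoSubtorusOfRank.natCard_eq {H : Subgroup (Fin m → ℤˣ)} {r : ℕ}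
    (hH : IsTwoSubtorusOfRank H r) : Nat.card H = 2 ^ r := by
  obtain ⟨e⟩ := hH
  simp [Nat.card_congr e.toEquiv]

lemma isCancelSMul_of_le {G Z : Type*} [Group G] [MulAction G Z] {A H : Subgroup G} (hAH : A ≤ H)
    [IsCancelSMul H Z] : IsCancelSMul A Z where
  right_cancel' a b z hab := Subgroup.inclusion_injective hAH
    (IsCancelSMul.right_cancel (Subgroup.inclusion hAH a) (Subgroup.inclusion hAH b) z hab)

end FreeAction

theorem theorem1p3_general {m : ℕ} (K : AbstractSimplicialComplex (Fin m)) (k : Type u) [Field k] :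
    totalBetti k (momentAngleComplex K) < Cardinal.aleph0 ∧
    totalBetti k (momentAngleComplex K) = totalBetti k (realMomentAngleComplex K) ∧
    (∀ A : Subgroup (Fin m → Circle), (∀ a ∈ A, a * a = 1) →
      IsCancelSMul A (momentAngleComplex K) →
      Nat.card A ≤ totalBetti k (momentAngleComplex K)) ∧
    (∀ A : Subgroup (Fin m → ℤˣ), IsCancelSMul A (realMomentAngleComplex K) →
      Nat.card A ≤ totalBetti k (realMomentAngleComplex K)) := by
  have := finite_momentAngleComplex K k
  have := finite_realMomentAngleComplex K k
  rw [totalBetti_eq_finrank k (momentAngleComplex K),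
    totalBetti_eq_finrank k (realMomentAngleComplex K), finrank_realMomentAngleComplex]
  refine ⟨Cardinal.natCast_lt_aleph0, rfl, fun A hA _ => ?_, fun A _ => ?_⟩ <;>
    refine Nat.cast_le.2 (le_finrank_momentAngleComplex K k fun σ hσ => ?_)
  · exact natCard_mul_two_pow_ncard_le_of_momentAngleComplex hσ hA
  · exact natCard_mul_two_pow_ncard_le_of_realMomentAngleComplex hσ

theorem theorem1p3 {m : ℕ} (K : AbstractSimplicialComplex (Fin m)) (k : Type u) [Field k] :
    totalBetti k (momentAngleComplex K) < Cardinal.aleph0 ∧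
    totalBetti k (momentAngleComplex K) = totalBetti k (realMomentAngleComplex K) ∧
    (∀ (r : ℕ) (H : Subgroup (Fin m → Circle)), IsSubtorusOfRank H r →
      IsCancelSMul H (momentAngleComplex K) →
      2 ^ r ≤ totalBetti k (momentAngleComplex K)) ∧
    (∀ (r : ℕ) (H : Subgroup (Fin m → ℤˣ)), IsTwoSubtorusOfRank H r →
      IsCancelSMul H (realMomentAngleComplex K) →
      2 ^ r ≤ totalBetti k (realMomentAngleComplex K)) := by
  obtain ⟨hfinite, heq, htorus, htwo⟩ := theorem1p3_general K k
  refine ⟨hfinite, heq, fun r H hH _ => ?_, fun r H hH hfree => ?_⟩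
  · obtain ⟨A, hAH, hA, hcard⟩ := hH.exists_le
    exact_mod_cast hcard ▸ htorus A hA (isCancelSMul_of_le hAH)
  · exact_mod_cast hH.natCard_eq ▸ htwo H hfree
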